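/- Let $Y$ be a primitive multiple curve over $\mathbb{C}$ of multiplicity $n$: a Cohen–Macaulay scheme of finite type over $\mathbb{C}$ such that $C=Y_{\mathrm{red}}$ is a smooth connected projective curve, $n$ is the smallest integer with $\mathcal{I}_C^{\,n}=0$ (where $\mathcal{I}_C\subset\mathcal{O}_Y$ is the ideal sheaf of $C$), and every closed point has a neighbourhood in $Y$ that is a locally closed subscheme of a smooth surface. For $1\le i\le n$ let $C_i\subset Y$ be the closed subscheme with ideal sheaf $\mathcal{I}_C^{\,i}$ and $\mathcal{O}_i=\mathcal{O}_{C_i}=\mathcal{O}_Y/\mathcal{I}_C^{\,i}$. For an $\mathcal{O}_Y$-module $\mathcal{F}$ put $\mathcal{F}_i=\mathcal{I}_C^{\,i}\mathcal{F}$, let $\mathcal{F}^{(i)}\subset\mathcal{F}$ be the subsheaf of sections annihilated by $\mathcal{I}_C^{\,i}$, and let $\mathcal{F}_{|C_i}=\mathcal{F}/\mathcal{I}_C^{\,i}\mathcal{F}$, regarded as an $\mathcal{O}_Y$-module. Let $a,b>0$ and $1\le k<n$ be integers, let $\mathcal{E}$ be a coherent sheaf on $Y$ locally isomorphic to $a\mathcal{O}_n\oplus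 b\mathcal{O}_k$, let $\mathbb{E}$ be a vector bundle on $Y$, let $\phi:\mathbb{E}\to\mathcal{E}$ be a surjective morphism inducing an isomorphism $\mathbb{E}_{|C}\simeq\mathcal{E}_{|C}$, and let $\mathcal{L}=\ker\phi$. Then there is a canonical isomorphism of $\mathcal{O}_Y$-modules \[\theta:\ \mathcal{L}_{|C_k}\ \simeq\ (\mathcal{E}^{(k)}/\mathcal{E}_{n-k})\otimes_{\mathcal{O}_Y}\mathcal{I}_C^{\,k}.\] Precisely, there is exactly one isomorphism $\theta$ such that, for every open $U\subset Y$ and all sections $u\in\mathcal{E}^{(k)}(U)$, $s\in\mathcal{I}_C^{\,k}(U)$ and $v\in\mathbb{E}(U)$ with $\phi(v)=u$, the class of $sv\in\mathcal{L}(U)$ in $\mathcal{L}_{|C_k}$ is sent to $[u]\otimes s$, where $[u]$ is the class of $u$ in $\mathcal{E}^{(k)}/\mathcal{E}_{n-k}$. -/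

import Mathlib

open CategoryTheory CategoryTheory.Limits AlgebraicGeometry TopologicalSpace

noncomputable section

namespace MultipleCurve

universe u

section SheavesOfModules

variable {Y : Scheme.{u}}

/-- A subsheaf of `𝒪_Y`-submodules of the `𝒪_Y`-module `M`: a family of submodules of the modules
of sections which is stable under restriction and whose membership is a local condition. -/
structure Subsheaf (M : Y.Modules) where
  obj (U : Y.Opens) : Submodule Γ(Y, U) Γ(M, U)
  res {U V : Y.Opens} (i : V ⟶ U) {s : Γ(M, U)} (hs : s ∈ obj U) :
    M.presheaf.map i.op s ∈ obj V
  local_mem {U : Y.Opens} {s : Γ(M, U)}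
    (hs : ∀ x ∈ U, ∃ (V : Y.Opens) (i : V ⟶ U), x ∈ V ∧ M.presheaf.map i.op s ∈ obj V) :
    s ∈ obj U

namespace Subsheaf

variable {M : Y.Modules}

/-- The underlying presheaf of submodules of a subsheaf. -/
def toSubmodule (N : Subsheaf M) : PresheafOfModules.Submodule M.val where
  obj U := N.obj U.unop
  map f _ hs := N.res f.unop hs

lemma isSheaf (N : Subsheaf M) :
    TopCat.Presheaf.IsSheaf N.toSubmodule.toPresheafOfModules.presheaf := by
  rw [TopCat.Presheaf.isSheaf_iff_isSheafUniqueGluing]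
  intro ι U sf hsf
  let F : TopCat.Sheaf Ab Y := ⟨M.presheaf, M.isSheaf⟩
  let sf' : ∀ i : ι, Γ(M, U i) := fun i ↦ (show N.obj (U i) from sf i).1
  have hsf' : TopCat.Presheaf.IsCompatible M.presheaf U sf' := fun i j ↦
    congrArg Subtype.val (hsf i j)
  obtain ⟨s, hs, hu⟩ := F.existsUnique_gluing U sf' hsf'
  have hmem : s ∈ N.obj (iSup U) := by
    refine N.local_mem fun x hx ↦ ?_
    obtain ⟨i, hi⟩ := Opens.mem_iSup.mp hx
    refine ⟨U i, Opens.leSupr U i, hi, ?_⟩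
    have := hs i
    change M.presheaf.map (Opens.leSupr U i).op s = _ at this
    rw [this]
    exact (show N.obj (U i) from sf i).2
  refine ⟨(⟨s, hmem⟩ : N.obj (iSup U)), fun i ↦ Subtype.ext (hs i), fun t ht ↦ ?_⟩
  exact Subtype.ext (hu (show N.obj (iSup U) from t).1 fun i ↦ congrArg Subtype.val (ht i))

/-- The `𝒪_Y`-module underlying a subsheaf of `M`. -/
def toModules (N : Subsheaf M) : Y.Modules :=
  ⟨N.toSubmodule.toPresheafOfModules, N.isSheaf⟩

/-- The inclusion of a subsheaf of `M` into `M`. -/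
def ι (N : Subsheaf M) : N.toModules ⟶ M :=
  ⟨N.toSubmodule.ι⟩

/-- The inclusion of a subsheaf of `M` into a larger one. -/
def homOfLE {N₁ N₂ : Subsheaf M} (h : ∀ U, N₁.obj U ≤ N₂.obj U) : N₁.toModules ⟶ N₂.toModules :=
  ⟨PresheafOfModules.Submodule.homOfLE (N₁ := N₁.toSubmodule) (N₂ := N₂.toSubmodule)
    (fun U ↦ h U.unop)⟩

end Subsheaf

lemma map_map (M : Y.Modules) {U V W : Y.Opens} (i : V ⟶ U) (j : W ⟶ V) (s : Γ(M, U)) :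
    M.presheaf.map j.op (M.presheaf.map i.op s) = M.presheaf.map (j ≫ i).op s := by
  rw [op_comp, Functor.map_comp]
  rfl

lemma map_mem_ideal (J : Y.IdealSheafData) {V W : Y.affineOpens} (j : W.1 ⟶ V.1) {a : Γ(Y, V.1)}
    (ha : a ∈ J.ideal V) : Y.presheaf.map j.op a ∈ J.ideal W := by
  have h := J.map_ideal (U := W) (V := V) (leOfHom j)
  rw [← h]
  exact Ideal.mem_map_of_mem _ ha

lemma map_mem_ideal_smul (J : Y.IdealSheafData) (M : Y.Modules) {V W : Y.affineOpens}
    (j : W.1 ⟶ V.1) {s : Γ(M, V.1)}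
    (hs : s ∈ (J.ideal V • ⊤ : Submodule Γ(Y, V.1) Γ(M, V.1))) :
    M.presheaf.map j.op s ∈ (J.ideal W • ⊤ : Submodule Γ(Y, W.1) Γ(M, W.1)) := by
  induction hs using Submodule.smul_induction_on' with
  | smul a ha m _ =>
    rw [Scheme.Modules.map_smul]
    exact Submodule.smul_mem_smul (map_mem_ideal J j ha) trivial
  | add x _ y _ hx hy =>
    rw [map_add]
    exact add_mem hx hy

lemma exists_affine (Y : Scheme.{u}) {U : Y.Opens} {x : Y} (hx : x ∈ U) :
    ∃ V : Y.affineOpens, x ∈ V.1 ∧ V.1 ≤ U := by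
  obtain ⟨_, ⟨V, hV, rfl⟩, hxV, hVU⟩ := Y.isBasis_affineOpens.exists_subset_of_mem_open hx U.2
  exact ⟨⟨V, hV⟩, hxV, hVU⟩

lemma eq_zero_of_locally (M : Y.Modules) {U : Y.Opens} (s : Γ(M, U))
    (h : ∀ x ∈ U, ∃ (V : Y.Opens) (i : V ⟶ U), x ∈ V ∧ M.presheaf.map i.op s = 0) : s = 0 := by
  let F : TopCat.Sheaf Ab Y := ⟨M.presheaf, M.isSheaf⟩
  choose V i hxV hV using h
  refine F.eq_of_locally_eq' (fun x : U ↦ V x.1 x.2) U (fun x ↦ i x.1 x.2) ?_ s 0 fun x ↦ ?_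
  · exact fun x hx ↦ Opens.mem_iSup.mpr ⟨⟨x, hx⟩, hxV x hx⟩
  · rw [map_zero]
    exact hV x.1 x.2

/-- The subsheaf `𝒥 M ⊆ M` for an ideal sheaf `𝒥`: its sections are the sections of `M` which,
locally on affine open subsets `V`, lie in `𝒥(V) M(V)`. -/
def idealSMul (J : Y.IdealSheafData) (M : Y.Modules) : Subsheaf M where
  obj U :=
    { carrier := {s | ∀ x ∈ U, ∃ (V : Y.affineOpens) (i : V.1 ⟶ U), x ∈ V.1 ∧
        M.presheaf.map i.op s ∈ (J.ideal V • ⊤ : Submodule Γ(Y, V.1) Γ(M, V.1))}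
      zero_mem' := fun x hx ↦ by
        obtain ⟨V, hxV, hV⟩ := exists_affine Y hx
        refine ⟨V, CategoryTheory.homOfLE hV, hxV, ?_⟩
        rw [map_zero]
        exact zero_mem _
      add_mem' := fun {s t} hs ht x hx ↦ by
        obtain ⟨V₁, i₁, hx₁, h₁⟩ := hs x hx
        obtain ⟨V₂, i₂, hx₂, h₂⟩ := ht x hx
        obtain ⟨V, hxV, hV⟩ := exists_affine Y (U := V₁.1 ⊓ V₂.1) ⟨hx₁, hx₂⟩
        let j₁ : V.1 ⟶ V₁.1 := CategoryTheory.homOfLE (hV.trans inf_le_left)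
        let j₂ : V.1 ⟶ V₂.1 := CategoryTheory.homOfLE (hV.trans inf_le_right)
        refine ⟨V, j₁ ≫ i₁, hxV, ?_⟩
        have e₁ := map_mem_ideal_smul J M j₁ h₁
        have e₂ := map_mem_ideal_smul J M j₂ h₂
        rw [map_map] at e₁ e₂
        rw [map_add]
        exact add_mem e₁ e₂
      smul_mem' := fun a s hs x hx ↦ by
        obtain ⟨V, i, hxV, h⟩ := hs x hx
        refine ⟨V, i, hxV, ?_⟩
        rw [Scheme.Modules.map_smul]
        exact Submodule.smul_mem _ _ h }
  res {U V} i s hs x hx := by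
    obtain ⟨W, j, hxW, h⟩ := hs x (leOfHom i hx)
    obtain ⟨W', hxW', hW'⟩ := exists_affine Y (U := W.1 ⊓ V) ⟨hxW, hx⟩
    refine ⟨W', CategoryTheory.homOfLE (hW'.trans inf_le_right), hxW', ?_⟩
    have e := map_mem_ideal_smul J M (CategoryTheory.homOfLE (hW'.trans inf_le_left)) h
    rw [map_map] at e ⊢
    exact e
  local_mem {U} s hs x hx := by
    obtain ⟨V, i, hxV, h⟩ := hs x hx
    obtain ⟨W, j, hxW, h'⟩ := h x hxV
    refine ⟨W, j ≫ i, hxW, ?_⟩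
    rw [map_map] at h'
    exact h'

/-- The subsheaf of the sections of `M` annihilated by the ideal sheaf `𝒥`. -/
def annihilated (J : Y.IdealSheafData) (M : Y.Modules) : Subsheaf M where
  obj U :=
    { carrier := {s | ∀ (V : Y.affineOpens) (i : V.1 ⟶ U), ∀ a ∈ J.ideal V,
        a • M.presheaf.map i.op s = 0}
      zero_mem' := fun V i a _ ↦ by rw [map_zero, smul_zero]
      add_mem' := fun {s t} hs ht V i a ha ↦ by
        rw [map_add, smul_add, hs V i a ha, ht V i a ha, add_zero]
      smul_mem' := fun c s hs V i a ha ↦ by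
        rw [Scheme.Modules.map_smul, smul_comm, hs V i a ha, smul_zero] }
  res {U V} i s hs W j a ha := by
    rw [map_map]
    exact hs W (j ≫ i) a ha
  local_mem {U} s hs V i a ha := by
    refine eq_zero_of_locally M _ fun x hx ↦ ?_
    obtain ⟨W, j, hxW, h⟩ := hs x (leOfHom i hx)
    obtain ⟨W', hxW', hW'⟩ := exists_affine Y (U := W ⊓ V.1) ⟨hxW, hx⟩
    let l : W'.1 ⟶ V.1 := CategoryTheory.homOfLE (hW'.trans inf_le_right)
    let l' : W'.1 ⟶ W := CategoryTheory.homOfLE (hW'.trans inf_le_left)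
    refine ⟨W'.1, l, hxW', ?_⟩
    have e := h W' l' _ (map_mem_ideal J l ha)
    rw [map_map] at e
    rw [Scheme.Modules.map_smul, map_map]
    exact e

lemma idealSMul_le_annihilated {J K : Y.IdealSheafData} (h : J * K = ⊥) (M : Y.Modules)
    (U : Y.Opens) : (idealSMul J M).obj U ≤ (annihilated K M).obj U := by
  intro s hs V i a ha
  refine eq_zero_of_locally M _ fun x hx ↦ ?_
  obtain ⟨W, j, hxW, hW⟩ := hs x (leOfHom i hx)
  obtain ⟨W', hxW', hW'⟩ := exists_affine Y (U := W.1 ⊓ V.1) ⟨hxW, hx⟩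
  let l : W'.1 ⟶ V.1 := CategoryTheory.homOfLE (hW'.trans inf_le_right)
  let l' : W'.1 ⟶ W.1 := CategoryTheory.homOfLE (hW'.trans inf_le_left)
  refine ⟨W'.1, l, hxW', ?_⟩
  have e := map_mem_ideal_smul J M l' hW
  have ha' := map_mem_ideal K l ha
  rw [map_map] at e
  rw [Scheme.Modules.map_smul, map_map]
  have key : ∀ t ∈ (J.ideal W' • ⊤ : Submodule Γ(Y, W'.1) Γ(M, W'.1)),
      ∀ c ∈ K.ideal W', c • t = 0 := by
    intro t ht c hc
    induction ht using Submodule.smul_induction_on' with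
    | smul b hb m _ =>
      have : b * c ∈ (J * K).ideal W' := Ideal.mul_mem_mul hb hc
      rw [h] at this
      have h0 : b * c = 0 := this
      rw [smul_smul, mul_comm, h0, zero_smul]
    | add x _ y _ hx hy => rw [smul_add, hx, hy, add_zero]
  exact key _ e _ ha'

/-- The presheaf `U ↦ M(U) ⊗_{𝒪_Y(U)} N(U)`. -/
def tensorPresheaf (M N : Y.Modules) : Y.PresheafOfModules :=
  PresheafOfModules.Monoidal.tensorObj (R := Y.presheaf) M.val N.val

/-- The tensor product `M ⊗_{𝒪_Y} N`, the sheaf associated with `U ↦ M(U) ⊗_{𝒪_Y(U)} N(U)`. -/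
def tensor (M N : Y.Modules) : Y.Modules :=
  (PresheafOfModules.sheafification (𝟙 Y.ringCatSheaf.obj)).obj (tensorPresheaf M N)

/-- The section `m ⊗ t` of `M ⊗_{𝒪_Y} N` defined by sections `m` of `M` and `t` of `N`. -/
def tmul {M N : Y.Modules} {U : Y.Opens} (m : Γ(M, U)) (t : Γ(N, U)) : Γ(tensor M N, U) :=
  (((PresheafOfModules.sheafificationAdjunction (𝟙 Y.ringCatSheaf.obj)).unit.app
    (tensorPresheaf M N)).app (.op U)).hom (m ⊗ₜ[Γ(Y, U)] t)

variable (Y) in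
/-- The structure sheaf `𝒪_Y` as a module over itself. -/
def structureSheaf : Y.Modules := SheafOfModules.unit Y.ringCatSheaf

/-- `M` and `N` are locally isomorphic on `Y`. -/
def LocallyIsomorphic (M N : Y.Modules) : Prop :=
  ∀ x : Y, ∃ U : Y.Opens, x ∈ U ∧ Nonempty (M.restrict U.ι ≅ N.restrict U.ι)

/-- Vector bundles: `𝒪_Y`-modules that are locally free of finite rank. -/
def IsVectorBundle (M : Y.Modules) : Prop :=
  ∀ x : Y, ∃ (U : Y.Opens) (r : ℕ), x ∈ U ∧
    Nonempty (M.restrict U.ι ≅ (∐ fun _ : Fin r ↦ structureSheaf Y).restrict U.ι)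

end SheavesOfModules

section Filtrations

/-! Here `C = Y_red`, so that the ideal sheaf `𝓘_C` of `C` in `Y` is `Y.nilradical`, and `C_i` is
the closed subscheme of `Y` with ideal sheaf `𝓘_C ^ i`. -/

variable {Y : Scheme.{u}}

/-- The term `M_i = 𝓘_C ^ i M` of the first canonical filtration of `M`. -/
def firstFiltration (M : Y.Modules) (i : ℕ) : Subsheaf M := idealSMul (Y.nilradical ^ i) M

/-- The term `M^(i)`, the sections annihilated by `𝓘_C ^ i`, of the second canonical filtration
of `M`. -/
def secondFiltration (M : Y.Modules) (i : ℕ) : Subsheaf M := annihilated (Y.nilradical ^ i) M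

/-- The restriction `M|_{C_i} = M / 𝓘_C ^ i M`, as an `𝒪_Y`-module. -/
def restrictTo (M : Y.Modules) (i : ℕ) : Y.Modules := cokernel (firstFiltration M i).ι

/-- The projection `M → M|_{C_i}`. -/
def toRestrict (M : Y.Modules) (i : ℕ) : M ⟶ restrictTo M i := cokernel.π (firstFiltration M i).ι

variable (Y) in
/-- `𝓘_C ^ i` as an `𝒪_Y`-module. -/
def idealPow (i : ℕ) : Y.Modules := (firstFiltration (structureSheaf Y) i).toModules

/-- The inclusion of `𝓘_C ^ i(U)` in `𝒪_Y(U)`. -/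
def idealPow.val {i : ℕ} {U : Y.Opens} (s : Γ(idealPow Y i, U)) : Γ(Y, U) :=
  (firstFiltration (structureSheaf Y) i).ι.app U s

lemma firstFiltration_le_secondFiltration {n k : ℕ} (hn : Y.nilradical ^ n = ⊥) (hk : k ≤ n)
    (M : Y.Modules) (U : Y.Opens) :
    (firstFiltration M (n - k)).obj U ≤ (secondFiltration M k).obj U :=
  idealSMul_le_annihilated (by rw [← pow_add, Nat.sub_add_cancel hk, hn]) M U

/-- The quotient `M^(k) / M_{n-k}`. -/
def filtrationQuotient {n k : ℕ} (hn : Y.nilradical ^ n = ⊥) (hk : k ≤ n) (M : Y.Modules) :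
    Y.Modules :=
  cokernel (Subsheaf.homOfLE (firstFiltration_le_secondFiltration hn hk M))

/-- The projection `M^(k) → M^(k) / M_{n-k}`. -/
def toFiltrationQuotient {n k : ℕ} (hn : Y.nilradical ^ n = ⊥) (hk : k ≤ n) (M : Y.Modules) :
    (secondFiltration M k).toModules ⟶ filtrationQuotient hn hk M :=
  cokernel.π (Subsheaf.homOfLE (firstFiltration_le_secondFiltration hn hk M))

variable (Y) in
/-- The `𝒪_Y`-module `a 𝒪_n ⊕ b 𝒪_k`, where `Y = C_n` and `𝒪_k = 𝒪_Y / 𝓘_C ^ k`. -/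
def quasiFreeModel (a b k : ℕ) : Y.Modules :=
  (∐ fun _ : Fin a ↦ structureSheaf Y) ⨿ (∐ fun _ : Fin b ↦ restrictTo (structureSheaf Y) k)

end Filtrations

section Curves

/-- A Cohen-Macaulay local ring: a Noetherian local ring `R` whose maximal ideal contains an
`R`-regular sequence of length `dim R`. -/
def IsCohenMacaulayLocalRing (R : Type*) [CommRing R] [IsLocalRing R] : Prop :=
  IsNoetherianRing R ∧ ∃ rs : List R, (∀ r ∈ rs, r ∈ IsLocalRing.maximalIdeal R) ∧
    RingTheory.Sequence.IsRegular R rs ∧ (rs.length : WithBot ℕ∞) = ringKrullDim R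

attribute [local instance] MvPolynomial.gradedAlgebra

/-- The projective space `ℙ^N` over `ℂ`. -/
def ProjSpace (N : ℕ) : Scheme.{0} :=
  Proj (MvPolynomial.homogeneousSubmodule (Fin (N + 1)) ℂ)

/-- The structure morphism of `ℙ^N`. -/
def ProjSpace.toSpec (N : ℕ) : ProjSpace N ⟶ Spec (.of ℂ) :=
  Proj.toSpecZero (MvPolynomial.homogeneousSubmodule (Fin (N + 1)) ℂ) ≫
    Spec.map (CommRingCat.ofHom
      (algebraMap ℂ (MvPolynomial.homogeneousSubmodule (Fin (N + 1)) ℂ 0)))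

/-- `X` is projective over `ℂ`. -/
def IsProjective {X : Scheme.{0}} (π : X ⟶ Spec (.of ℂ)) : Prop :=
  ∃ (N : ℕ) (j : X ⟶ ProjSpace N), IsClosedImmersion j ∧ j ≫ ProjSpace.toSpec N = π

/-- `Y_red` is a smooth connected projective curve over `ℂ`. -/
structure ReducedIsSmoothProjectiveCurve {Y : Scheme.{0}} (π : Y ⟶ Spec (.of ℂ)) : Prop where
  smooth : SmoothOfRelativeDimension 1 (Y.nilradical.subschemeι ≫ π)
  connected : ConnectedSpace Y.nilradical.subscheme
  projective : IsProjective (Y.nilradical.subschemeι ≫ π)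

/-- `Y` is a primitive multiple curve of multiplicity `n` over `ℂ`, with support `C = Y_red`:
a Cohen-Macaulay scheme (of finite type) such that `C` is a smooth connected projective curve,
that `n` is the smallest integer with `𝓘_C ^ n = 0`, and that every closed point has a
neighbourhood in `Y` which can be embedded as a locally closed subscheme of a smooth surface. -/
structure IsPrimitiveMultipleCurve {Y : Scheme.{0}} (π : Y ⟶ Spec (.of ℂ)) (n : ℕ) : Prop where
  locallyOfFiniteType : LocallyOfFiniteType π
  support : ReducedIsSmoothProjectiveCurve π
  cohenMacaulay : ∀ x : Y, IsCohenMacaulayLocalRing (Y.presheaf.stalk x)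
  multiplicity : IsLeast {m : ℕ | Y.nilradical ^ m = ⊥} n
  primitive : ∀ x : Y, IsClosed {x} → ∃ (S : Scheme.{0}) (σ : S ⟶ Spec (.of ℂ))
    (U : Y.Opens) (j : (U : Scheme.{0}) ⟶ S), x ∈ U ∧ SmoothOfRelativeDimension 2 σ ∧
      IsImmersion j ∧ j ≫ σ = U.ι ≫ π

end Curves

end MultipleCurve

end

open MultipleCurve

/-! Near every point of Y the ideal of C is generated by one section z with z^n = 0 such that the
annihilator of z^k is generated by z^(n-k) (`IsPrimitiveMultipleCurve.exists_isLocalParameter`).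
Grant this, and let E → ℰ be the surjection φ with kernel L. As φ is an isomorphism on C, L ⊂ zE.
Lifts to E of local generators of ℰ therefore generate E, because z is nilpotent; since relations
between the generators of ℰ have coefficients in (z^k), it follows that L ⊂ z^k E
(`IsLocalParameter.exists_local_eq_of_app_eq_zero`).

So a section of L is locally l = z^k v, and z^k φ(v) = 0 puts φ(v) in ℰ^(k). Here v is unique up to
the annihilator of z^k in E, which is z^(n-k) E, so the class [φ(v)] modulo ℰ_{n-k} depends only on
l and z. The map l ↦ [φ(v)] ⊗ z^k kills z^k L, where v can be taken in L. If [φ(v)] ⊗ z^k = 0, then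
φ(v) = φ(z^(n-k) p) for some p, and l = z^k (v - z^(n-k) p) lies in z^k L. Local lifts of u to E
give surjectivity. No choice of z enters the map itself: it is the morphism whose graph is the
relation `ComparisonRel`, obtained by `exists_hom_of_local_graph`.

For the existence of z, let R be the local ring of Y at a closed point, a quotient of the local ring
A of a smooth surface, and let D = R_red be the local ring of C. The conormal sequence and
Nakayama's lemma show that ker(A → D) is principal
(`IsFormallySmoothOfRank.exists_ker_eq_span_singleton`), so the nilradical of R is (z). The
Cohen–Macaulay property provides a regular element of the maximal ideal, and Krull's intersection
theorem then shows that the last nonzero power of z has annihilator (z) (`dvd_of_pow_mul_eq_zero`).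
These properties spread to a neighbourhood; the nilpotency order is constant because Y is connected,
and equals n by minimality of n. -/

noncomputable section

namespace MultipleCurve

universe u

/-! ### Sections, restriction maps, and morphisms defined by local graphs. -/

section Sections

variable {Y : Scheme.{u}}

/-- Restriction of sections of the structure sheaf. -/
def ringRes {U V : Y.Opens} (h : V ≤ U) : Γ(Y, U) →+* Γ(Y, V) :=
  (Y.presheaf.map (CategoryTheory.homOfLE h).op).hom

/-- Restriction of sections of a sheaf of modules. -/
def secRes {M : Y.Modules} {U V : Y.Opens} (h : V ≤ U) : Γ(M, U) →+ Γ(M, V) :=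
  (M.presheaf.map (CategoryTheory.homOfLE h).op).hom

lemma secRes_eq {M : Y.Modules} {U V : Y.Opens} (i : V ⟶ U) (s : Γ(M, U)) :
    M.presheaf.map i.op s = secRes (leOfHom i) s := rfl

@[simp] lemma secRes_secRes {M : Y.Modules} {U V W : Y.Opens} (h : V ≤ U) (h' : W ≤ V)
    (s : Γ(M, U)) : secRes h' (secRes h s) = secRes (h'.trans h) s :=
  map_map M (CategoryTheory.homOfLE h) (CategoryTheory.homOfLE h') s

@[simp] lemma secRes_self {M : Y.Modules} {U : Y.Opens} (h : U ≤ U) (s : Γ(M, U)) :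
    secRes h s = s := by
  change M.presheaf.map (𝟙 U).op s = s
  rw [op_id, M.presheaf.map_id]
  rfl

@[simp] lemma ringRes_ringRes {U V W : Y.Opens} (h : V ≤ U) (h' : W ≤ V)
    (s : Γ(Y, U)) : ringRes h' (ringRes h s) = ringRes (h'.trans h) s := by
  change (Y.presheaf.map (CategoryTheory.homOfLE h).op ≫
    Y.presheaf.map (CategoryTheory.homOfLE h').op).hom s = _
  rw [← Functor.map_comp]
  rfl

@[simp] lemma ringRes_self {U : Y.Opens} (h : U ≤ U) (s : Γ(Y, U)) : ringRes h s = s := by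
  change Y.presheaf.map (𝟙 U).op s = s
  rw [op_id, Y.presheaf.map_id]
  rfl

@[simp] lemma secRes_smul {M : Y.Modules} {U V : Y.Opens} (h : V ≤ U) (a : Γ(Y, U))
    (s : Γ(M, U)) : secRes h (a • s) = ringRes h a • secRes h s :=
  Scheme.Modules.map_smul M _ a s

lemma app_secRes {M N : Y.Modules} (f : M ⟶ N) {U V : Y.Opens} (h : V ≤ U) (s : Γ(M, U)) :
    f.app V (secRes h s) = secRes h (f.app U s) :=
  congr($(f.mapPresheaf.naturality (CategoryTheory.homOfLE h).op) s)

lemma comp_app_apply {M N K : Y.Modules} (f : M ⟶ N) (g : N ⟶ K) (U : Y.Opens) (s : Γ(M, U)) :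
    (f ≫ g).app U s = g.app U (f.app U s) := rfl

lemma hom_ext_apply {M N : Y.Modules} {f g : M ⟶ N}
    (h : ∀ (U : Y.Opens) (s : Γ(M, U)), f.app U s = g.app U s) : f = g := by
  ext U s
  exact h U s

lemma eq_zero_of_local (M : Y.Modules) {U : Y.Opens} (s : Γ(M, U))
    (h : ∀ x ∈ U, ∃ (V : Y.Opens) (i : V ≤ U), x ∈ V ∧ secRes i s = 0) : s = 0 :=
  eq_zero_of_locally M s fun x hx ↦ by
    obtain ⟨V, i, hV, h0⟩ := h x hx
    exact ⟨V, CategoryTheory.homOfLE i, hV, h0⟩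

lemma eq_of_local (M : Y.Modules) {U : Y.Opens} (s t : Γ(M, U))
    (h : ∀ x ∈ U, ∃ (V : Y.Opens) (i : V ≤ U), x ∈ V ∧ secRes i s = secRes i t) : s = t := by
  rw [← sub_eq_zero]
  refine eq_zero_of_local M _ fun x hx ↦ ?_
  obtain ⟨V, i, hV, h0⟩ := h x hx
  exact ⟨V, i, hV, by rw [map_sub, h0, sub_self]⟩

/-- A linear relation between the sections of two sheaves of modules which is local, locally
functional, and locally total is the graph of a morphism. -/
lemma exists_hom_of_local_graph {M N : Y.Modules} (r : ∀ U : Y.Opens, Γ(M, U) → Γ(N, U) → Prop)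
    (res : ∀ {U V : Y.Opens} (h : V ≤ U) {m : Γ(M, U)} {t : Γ(N, U)}, r U m t →
      r V (secRes h m) (secRes h t))
    (loc : ∀ {U : Y.Opens} {m : Γ(M, U)} {t : Γ(N, U)}, (∀ x ∈ U, ∃ (V : Y.Opens) (h : V ≤ U),
      x ∈ V ∧ r V (secRes h m) (secRes h t)) → r U m t)
    (add : ∀ {U : Y.Opens} {m m' : Γ(M, U)} {t t' : Γ(N, U)}, r U m t → r U m' t' →
      r U (m + m') (t + t'))
    (smul : ∀ {U : Y.Opens} (a : Γ(Y, U)) {m : Γ(M, U)} {t : Γ(N, U)}, r U m t →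
      r U (a • m) (a • t))
    (uniq : ∀ {U : Y.Opens} {t : Γ(N, U)}, r U 0 t → t = 0)
    (ex : ∀ {U : Y.Opens} (m : Γ(M, U)), ∀ x ∈ U, ∃ (V : Y.Opens) (h : V ≤ U) (t : Γ(N, V)),
      x ∈ V ∧ r V (secRes h m) t) :
    ∃ f : M ⟶ N, ∀ (U : Y.Opens) (m : Γ(M, U)) (t : Γ(N, U)), r U m t ↔ f.app U m = t := by
  have uniq' : ∀ {U : Y.Opens} {m : Γ(M, U)} {t t' : Γ(N, U)}, r U m t → r U m t' → t = t' := by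
    intro U m t t' h h'
    have := add h (smul (-1) h')
    rw [neg_one_smul, neg_one_smul, add_neg_cancel] at this
    rw [← sub_eq_zero, sub_eq_add_neg]
    exact uniq this
  have ex' : ∀ {U : Y.Opens} (m : Γ(M, U)), ∃ t, r U m t := by
    intro U m
    let F : TopCat.Sheaf Ab Y := ⟨N.presheaf, N.isSheaf⟩
    choose V h t hxV ht using fun x : U ↦ ex m x.1 x.2
    -- Functionality of the relation makes the local values agree on overlaps, so they glue.
    obtain ⟨s, hs, -⟩ := F.existsUnique_gluing' V U (fun x ↦ CategoryTheory.homOfLE (h x))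
      (fun x hx ↦ Opens.mem_iSup.mpr ⟨⟨x, hx⟩, hxV ⟨x, hx⟩⟩) t (by
        intro x y
        have h1 := res (inf_le_left : V x ⊓ V y ≤ V x) (ht x)
        have h2 := res (inf_le_right : V x ⊓ V y ≤ V y) (ht y)
        rw [secRes_secRes] at h1 h2
        exact uniq' h1 h2)
    refine ⟨s, loc fun x hx ↦ ⟨V ⟨x, hx⟩, h ⟨x, hx⟩, hxV _, ?_⟩⟩
    have := hs ⟨x, hx⟩
    change secRes (h ⟨x, hx⟩) s = _ at this
    rw [this]
    exact ht _
  choose g hg using @ex'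
  let F : M.val ⟶ N.val :=
    { app := fun U ↦ ModuleCat.ofHom (X := M.val.obj U) (Y := N.val.obj U)
        { toFun := fun m ↦ g (U := U.unop) m
          map_add' := fun a b ↦ uniq' (hg _) (add (hg _) (hg _))
          map_smul' := fun a b ↦ uniq' (hg _) (smul a (hg _)) }
      naturality := by
        intro U V i
        ext m
        exact uniq' (hg (secRes (leOfHom i.unop) m)) (res (leOfHom i.unop) (hg m)) }
  refine ⟨⟨F⟩, fun U m t ↦ ⟨fun h ↦ uniq' (hg m) h, fun h ↦ ?_⟩⟩
  rw [← h]
  exact hg m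

end Sections

/-! ### Exactness properties of sheaves of modules, read on sections. -/

section Exactness

variable {Y : Scheme.{u}}

instance preservesFiniteLimits_sections (U : Y.Opens) : PreservesFiniteLimits
    (Scheme.Modules.toPresheaf Y ⋙ (evaluation _ Ab).obj (.op U)) := by
  have : PreservesFiniteLimits ((evaluation (Y.Opens)ᵒᵖ Ab).obj (.op U)) := inferInstance
  have : PreservesFiniteLimits (Scheme.Modules.toPresheaf Y) := inferInstance
  exact comp_preservesFiniteLimits _ _

lemma app_injective_of_mono {M N : Y.Modules} (f : M ⟶ N) [Mono f] (U : Y.Opens) :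
    Function.Injective (f.app U) := by
  let F := (Scheme.Modules.toPresheaf Y) ⋙ (evaluation _ Ab).obj (.op U)
  have : PreservesFiniteLimits F := preservesFiniteLimits_sections U
  have : Mono (F.map f) := inferInstance
  exact (AddCommGrpCat.mono_iff_injective _).mp this

lemma exists_app_eq_of_exact {M N K : Y.Modules} (f : M ⟶ N) (g : N ⟶ K) [Mono f]
    (w : f ≫ g = 0) (h : (ShortComplex.mk f g w).Exact) (U : Y.Opens) (s : Γ(N, U))
    (hs : g.app U s = 0) : ∃ m, f.app U m = s := by
  let F := (Scheme.Modules.toPresheaf Y) ⋙ (evaluation _ Ab).obj (.op U)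
  have : F.PreservesZeroMorphisms := ⟨fun _ _ ↦ rfl⟩
  have : PreservesFiniteLimits F := preservesFiniteLimits_sections U
  have e := h.map_of_mono_of_preservesKernel F ‹_› inferInstance
  exact (ShortComplex.ab_exact_iff _).mp e s hs

lemma exists_kernel_ι_app_eq {M N : Y.Modules} (f : M ⟶ N) (U : Y.Opens) (s : Γ(M, U))
    (hs : f.app U s = 0) : ∃ m, (kernel.ι f).app U m = s :=
  exists_app_eq_of_exact _ f (kernel.condition f)
    (ShortComplex.exact_of_f_is_kernel _ (kernelIsKernel f)) U s hs

lemma app_kernel_ι_app {M N : Y.Modules} (f : M ⟶ N) (U : Y.Opens) (s : Γ(kernel f, U)) :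
    f.app U ((kernel.ι f).app U s) = 0 := by
  rw [← comp_app_apply, kernel.condition]
  rfl

/-- A monomorphism is the kernel of its cokernel, so left exactness of sections is enough, although
the cokernel is not computed on sections. -/
lemma exists_app_eq_of_cokernel_π {M N : Y.Modules} (f : M ⟶ N) [Mono f] (U : Y.Opens)
    (s : Γ(N, U)) (hs : (cokernel.π f).app U s = 0) : ∃ m, f.app U m = s :=
  exists_app_eq_of_exact f _ (cokernel.condition f)
    (ShortComplex.exact_of_g_is_cokernel _ (cokernelIsCokernel f)) U s hs

lemma cokernel_π_app_app {M N : Y.Modules} (f : M ⟶ N) (U : Y.Opens) (s : Γ(M, U)) :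
    (cokernel.π f).app U (f.app U s) = 0 := by
  rw [← comp_app_apply, cokernel.condition]
  rfl

lemma Subsheaf.ι_app_mem {M : Y.Modules} (N : Subsheaf M) {U : Y.Opens}
    (s : Γ(N.toModules, U)) : N.ι.app U s ∈ N.obj U :=
  (show N.obj U from s).2

lemma Subsheaf.exists_ι_app_eq {M : Y.Modules} (N : Subsheaf M) {U : Y.Opens} {s : Γ(M, U)}
    (hs : s ∈ N.obj U) : ∃ t : Γ(N.toModules, U), N.ι.app U t = s :=
  ⟨(⟨s, hs⟩ : N.obj U), rfl⟩

lemma Subsheaf.ι_app_injective {M : Y.Modules} (N : Subsheaf M) (U : Y.Opens) :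
    Function.Injective (N.ι.app U) :=
  fun s t h ↦ Subtype.ext (p := fun x ↦ x ∈ N.obj U) h

lemma mono_of_app_injective {M N : Y.Modules} (f : M ⟶ N)
    (h : ∀ U, Function.Injective (f.app U)) : Mono f :=
  ⟨fun a b hab ↦ hom_ext_apply fun U s ↦ h U <| by
    rw [← comp_app_apply, hab, comp_app_apply]⟩

instance {M : Y.Modules} (N : Subsheaf M) : Mono N.ι :=
  mono_of_app_injective _ N.ι_app_injective

instance {M : Y.Modules} {N₁ N₂ : Subsheaf M} (h : ∀ U, N₁.obj U ≤ N₂.obj U) :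
    Mono (Subsheaf.homOfLE h) :=
  mono_of_mono_fac (show Subsheaf.homOfLE h ≫ N₂.ι = N₁.ι from rfl)

lemma Subsheaf.cokernel_π_eq_zero_iff {M : Y.Modules} (N : Subsheaf M) {U : Y.Opens}
    (s : Γ(M, U)) : (cokernel.π N.ι).app U s = 0 ↔ s ∈ N.obj U := by
  refine ⟨fun h ↦ ?_, fun h ↦ ?_⟩
  · obtain ⟨m, rfl⟩ := exists_app_eq_of_cokernel_π _ _ _ h
    exact N.ι_app_mem m
  · obtain ⟨m, rfl⟩ := N.exists_ι_app_eq h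
    exact cokernel_π_app_app _ _ _

lemma Subsheaf.cokernel_π_homOfLE_eq_zero_iff {M : Y.Modules} {N₁ N₂ : Subsheaf M}
    (h : ∀ U, N₁.obj U ≤ N₂.obj U) {U : Y.Opens} (s : Γ(N₂.toModules, U)) :
    (cokernel.π (Subsheaf.homOfLE h)).app U s = 0 ↔ N₂.ι.app U s ∈ N₁.obj U := by
  refine ⟨fun hs ↦ ?_, fun hs ↦ ?_⟩
  · obtain ⟨m, rfl⟩ := exists_app_eq_of_cokernel_π _ _ _ hs
    exact N₁.ι_app_mem m
  · obtain ⟨m, hm⟩ := N₁.exists_ι_app_eq hs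
    have : s = (Subsheaf.homOfLE h).app U m := N₂.ι_app_injective U hm.symm
    rw [this]
    exact cokernel_π_app_app _ _ _

/-- The image of a morphism: the sections that locally come from the source. -/
def imageSubsheaf {M N : Y.Modules} (f : M ⟶ N) : Subsheaf N where
  obj U :=
    { carrier := {s | ∀ x ∈ U, ∃ (V : Y.Opens) (h : V ≤ U) (m : Γ(M, V)), x ∈ V ∧
        f.app V m = secRes h s}
      zero_mem' := fun x hx ↦ ⟨U, le_rfl, 0, hx, by simp⟩
      add_mem' := fun {_ _} hs ht x hx ↦ by
        obtain ⟨V, h, m, hV, e⟩ := hs x hx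
        obtain ⟨V', h', m', hV', e'⟩ := ht x hx
        refine ⟨V ⊓ V', inf_le_left.trans h,
          secRes inf_le_left m + secRes inf_le_right m', ⟨hV, hV'⟩, ?_⟩
        rw [map_add, app_secRes, app_secRes, e, e', secRes_secRes, secRes_secRes, map_add]
      smul_mem' := fun a s hs x hx ↦ by
        obtain ⟨V, h, m, hV, e⟩ := hs x hx
        exact ⟨V, h, ringRes h a • m, hV, by
          rw [Scheme.Modules.Hom.app_smul, e, secRes_smul]⟩ }
  res {U V} i s hs x hx := by
    obtain ⟨W, h, m, hW, e⟩ := hs x (leOfHom i hx)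
    refine ⟨W ⊓ V, inf_le_right, secRes inf_le_left m, ⟨hW, hx⟩, ?_⟩
    rw [app_secRes, e, secRes_eq, secRes_secRes, secRes_secRes]
  local_mem {U} s hs x hx := by
    obtain ⟨V, i, hxV, h⟩ := hs x hx
    obtain ⟨W, h, m, hW, e⟩ := h x hxV
    refine ⟨W, h.trans (leOfHom i), m, hW, ?_⟩
    rw [e, secRes_eq, secRes_secRes]

/-- The quotient of `N` by the image subsheaf receives the zero map from `M`, so its projection
vanishes because `f` is epi. Every section then lies in the image subsheaf, which is defined by
local preimages. -/
lemma exists_local_preimage {M N : Y.Modules} (f : M ⟶ N) [Epi f] {U : Y.Opens} (s : Γ(N, U))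
    {x : Y} (hx : x ∈ U) :
    ∃ (V : Y.Opens) (h : V ≤ U) (m : Γ(M, V)), x ∈ V ∧ f.app V m = secRes h s := by
  have h0 : cokernel.π (imageSubsheaf f).ι = 0 := by
    rw [← cancel_epi f, comp_zero]
    refine hom_ext_apply fun V m ↦ ?_
    rw [comp_app_apply]
    exact ((imageSubsheaf f).cokernel_π_eq_zero_iff _).mpr
      fun x hx ↦ ⟨V, le_rfl, m, hx, by simp⟩
  have : s ∈ (imageSubsheaf f).obj U := by
    rw [← Subsheaf.cokernel_π_eq_zero_iff, h0]
    rfl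
  exact this x hx

lemma epi_of_local_preimage {M N : Y.Modules} (f : M ⟶ N)
    (h : ∀ (U : Y.Opens) (s : Γ(N, U)), ∀ x ∈ U,
      ∃ (V : Y.Opens) (h : V ≤ U) (m : Γ(M, V)), x ∈ V ∧ f.app V m = secRes h s) : Epi f := by
  refine ⟨fun a b hab ↦ hom_ext_apply fun U s ↦ eq_of_local _ _ _ fun x hx ↦ ?_⟩
  obtain ⟨V, hV, m, hxV, e⟩ := h U s x hx
  refine ⟨V, hV, hxV, ?_⟩
  rw [← app_secRes, ← app_secRes, ← e, ← comp_app_apply, hab, comp_app_apply]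

end Exactness

end MultipleCurve

end

noncomputable section

open scoped TensorProduct

namespace MultipleCurve

universe u

/-! ### The tensor product sheaf and its local sections. -/

section Tensor

variable {Y : Scheme.{u}}

/-- The canonical map from the presheaf tensor product to the tensor product. -/
def toTensor (M N : Y.Modules) (U : Y.Opens) :
    Γ(M, U) ⊗[Γ(Y, U)] Γ(N, U) →ₗ[Γ(Y, U)] Γ(tensor M N, U) :=
  (((PresheafOfModules.sheafificationAdjunction (𝟙 Y.ringCatSheaf.obj)).unit.app
    (tensorPresheaf M N)).app (.op U)).hom

lemma tmul_eq {M N : Y.Modules} {U : Y.Opens} (m : Γ(M, U)) (t : Γ(N, U)) :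
    tmul m t = toTensor M N U (m ⊗ₜ t) := rfl

lemma smul_tmul' {M N : Y.Modules} {U : Y.Opens} (a : Γ(Y, U)) (m : Γ(M, U)) (t : Γ(N, U)) :
    tmul (a • m) t = a • tmul m t := by
  rw [tmul_eq, tmul_eq, ← TensorProduct.smul_tmul', map_smul]

lemma tmul_smul {M N : Y.Modules} {U : Y.Opens} (a : Γ(Y, U)) (m : Γ(M, U)) (t : Γ(N, U)) :
    tmul m (a • t) = tmul (a • m) t := by
  rw [tmul_eq, tmul_eq, TensorProduct.tmul_smul, TensorProduct.smul_tmul']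

lemma add_tmul {M N : Y.Modules} {U : Y.Opens} (m m' : Γ(M, U)) (t : Γ(N, U)) :
    tmul (m + m') t = tmul m t + tmul m' t := by
  rw [tmul_eq, TensorProduct.add_tmul, map_add]
  rfl

lemma zero_tmul {M N : Y.Modules} {U : Y.Opens} (t : Γ(N, U)) :
    tmul (0 : Γ(M, U)) t = 0 := by
  rw [tmul_eq, TensorProduct.zero_tmul, map_zero]

lemma secRes_tmul {M N : Y.Modules} {U V : Y.Opens} (h : V ≤ U) (m : Γ(M, U)) (t : Γ(N, U)) :
    secRes h (tmul m t) = tmul (secRes h m) (secRes h t) := by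
  let η := (PresheafOfModules.sheafificationAdjunction (𝟙 Y.ringCatSheaf.obj)).unit.app
    (tensorPresheaf M N)
  exact (PresheafOfModules.naturality_apply η (CategoryTheory.homOfLE h).op
    (m ⊗ₜ[Γ(Y, U)] t)).symm

/-- The unit of sheafification is locally surjective. -/
lemma exists_local_toTensor_eq {M N : Y.Modules} {U : Y.Opens} (t : Γ(tensor M N, U)) {x : Y}
    (hx : x ∈ U) : ∃ (V : Y.Opens) (h : V ≤ U) (y : Γ(M, V) ⊗[Γ(Y, V)] Γ(N, V)), x ∈ V ∧
      toTensor M N V y = secRes h t := by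
  have : Presheaf.IsLocallySurjective (Opens.grothendieckTopology Y)
    (CategoryTheory.toSheafify (Opens.grothendieckTopology Y) (tensorPresheaf M N).presheaf) :=
      inferInstance
  obtain ⟨V, i, ⟨y, hy⟩, hV⟩ := this.imageSieve_mem t x hx
  exact ⟨V, leOfHom i, y, hV, hy⟩

/-- The unit of sheafification is also locally injective. The open set is taken affine because the
relation is later exploited in a module over the ring of an affine open. -/
lemma exists_local_tmul_eq_zero {M N : Y.Modules} {U : Y.Opens} (m : Γ(M, U)) (t : Γ(N, U))
    (h0 : tmul m t = 0) {x : Y} (hx : x ∈ U) : ∃ (V : Y.affineOpens) (h : V.1 ≤ U), x ∈ V.1 ∧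
      secRes h m ⊗ₜ[Γ(Y, V.1)] secRes h t = 0 := by
  have : Presheaf.IsLocallyInjective (Opens.grothendieckTopology Y)
      (CategoryTheory.toSheafify (Opens.grothendieckTopology Y) (tensorPresheaf M N).presheaf) :=
    inferInstance
  obtain ⟨V, i, hi, hV⟩ := this.equalizerSieve_mem
    (m ⊗ₜ[Γ(Y, U)] t : Γ(M, U) ⊗[Γ(Y, U)] Γ(N, U)) 0
    (h0.trans (map_zero (toTensor M N U)).symm) x hx
  obtain ⟨W, hxW, hW⟩ := exists_affine Y hV
  have hi' := (Presheaf.equalizerSieve _ _).downward_closed hi (CategoryTheory.homOfLE hW)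
  exact ⟨W, hW.trans (leOfHom i), hxW, hi'.trans (map_zero _)⟩

end Tensor
end MultipleCurve

end

noncomputable section

namespace MultipleCurve

universe u

/-! ### Local equations of C and the powers of its ideal. -/

section LocalParameter

variable {Y : Scheme.{u}}

/-- `z` is a local equation on `V` of the reduced subscheme `C` of `Y`, with `z ^ n = 0`, such that
the annihilator of `z ^ k` is generated by `z ^ (n - k)`. -/
structure IsLocalParameter (n : ℕ) (V : Y.Opens) (z : Γ(Y, V)) : Prop where
  ideal_eq (W : Y.affineOpens) (h : W.1 ≤ V) : Y.nilradical.ideal W = Ideal.span {ringRes h z}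
  pow_eq_zero : z ^ n = 0
  exists_eq_of_pow_mul_eq_zero (W : Y.affineOpens) (h : W.1 ≤ V) (k : ℕ) (hk : k ≤ n)
    (c : Γ(Y, W.1)) (hc : ringRes h z ^ k * c = 0) : ∃ d, c = ringRes h z ^ (n - k) * d

variable {n : ℕ} {V : Y.Opens} {z : Γ(Y, V)}

lemma IsLocalParameter.pow_ideal_eq (hz : IsLocalParameter n V z) (W : Y.affineOpens)
    (h : W.1 ≤ V) (i : ℕ) : (Y.nilradical ^ i).ideal W = Ideal.span {ringRes h z ^ i} := by
  rw [Scheme.IdealSheafData.ideal_pow, Pi.pow_apply, hz.ideal_eq W h, Ideal.span_singleton_pow]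

/-- Where the ideal is principal, lying in its `i`-th power times `M` is local divisibility by `z ^
i`; this frees later arguments from affine opens. -/
lemma IsLocalParameter.mem_firstFiltration_iff (hz : IsLocalParameter n V z) {M : Y.Modules}
    {U : Y.Opens} (hU : U ≤ V) (i : ℕ) (s : Γ(M, U)) :
    s ∈ (firstFiltration M i).obj U ↔ ∀ x ∈ U, ∃ (W : Y.Opens) (h : W ≤ U) (m : Γ(M, W)), x ∈ W ∧
      secRes h s = ringRes (h.trans hU) z ^ i • m := by
  constructor
  · intro hs x hx
    obtain ⟨W, j, hxW, hW⟩ := hs x hx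
    rw [hz.pow_ideal_eq W ((leOfHom j).trans hU), Submodule.ideal_span_singleton_smul,
      Submodule.mem_smul_pointwise_iff_exists] at hW
    obtain ⟨m, -, hm⟩ := hW
    exact ⟨W.1, leOfHom j, m, hxW, hm.symm⟩
  · intro hs x hx
    obtain ⟨W, h, m, hxW, e⟩ := hs x hx
    obtain ⟨W', hxW', hW'⟩ := exists_affine Y hxW
    refine ⟨W', CategoryTheory.homOfLE (hW'.trans h), hxW', ?_⟩
    rw [hz.pow_ideal_eq W' (hW'.trans (h.trans hU)), Submodule.ideal_span_singleton_smul,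
      Submodule.mem_smul_pointwise_iff_exists]
    refine ⟨secRes hW' m, trivial, ?_⟩
    have := congrArg (secRes hW') e
    rw [secRes_secRes, secRes_smul, map_pow, ringRes_ringRes] at this
    exact this.symm

lemma IsLocalParameter.mem_secondFiltration (hz : IsLocalParameter n V z) {M : Y.Modules}
    {U : Y.Opens} (hU : U ≤ V) (i : ℕ) (s : Γ(M, U)) (hs : ringRes hU z ^ i • s = 0) :
    s ∈ (secondFiltration M i).obj U := by
  intro W j a ha
  rw [hz.pow_ideal_eq W ((leOfHom j).trans hU), Ideal.mem_span_singleton'] at ha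
  obtain ⟨b, rfl⟩ := ha
  have := congrArg (secRes (leOfHom j)) hs
  rw [secRes_smul, map_pow, ringRes_ringRes, map_zero] at this
  rw [secRes_eq, mul_smul, this, smul_zero]

lemma IsLocalParameter.exists_idealPow_eq (hz : IsLocalParameter n V z) (k : ℕ)
    {U : Y.Opens} (hU : U ≤ V) : ∃ s : Γ(idealPow Y k, U), idealPow.val s = ringRes hU z ^ k := by
  refine Subsheaf.exists_ι_app_eq (firstFiltration (structureSheaf Y) k)
    (s := (ringRes hU z ^ k : Γ(Y, U))) ((hz.mem_firstFiltration_iff hU k _).mpr fun x hx ↦ ?_)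
  refine ⟨U, le_rfl, (1 : Γ(Y, U)), hx, ?_⟩
  exact (ringRes_self le_rfl (ringRes hU z ^ k)).trans (mul_one _).symm

/-- The generator of `𝓘_C ^ k` defined by a local parameter. -/
def IsLocalParameter.gen (hz : IsLocalParameter n V z) (k : ℕ) {U : Y.Opens} (hU : U ≤ V) :
    Γ(idealPow Y k, U) := (hz.exists_idealPow_eq k hU).choose

lemma IsLocalParameter.val_gen (hz : IsLocalParameter n V z) (k : ℕ) {U : Y.Opens} (hU : U ≤ V) :
    idealPow.val (hz.gen k hU) = ringRes hU z ^ k := (hz.exists_idealPow_eq k hU).choose_spec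

lemma idealPow.val_injective {k : ℕ} {U : Y.Opens} :
    Function.Injective (idealPow.val (Y := Y) (i := k) (U := U)) :=
  Subsheaf.ι_app_injective _ _

lemma idealPow.val_smul {k : ℕ} {U : Y.Opens} (a : Γ(Y, U)) (s : Γ(idealPow Y k, U)) :
    idealPow.val (a • s) = a * idealPow.val s := rfl

lemma idealPow.val_secRes {k : ℕ} {U W : Y.Opens} (h : W ≤ U) (s : Γ(idealPow Y k, U)) :
    idealPow.val (secRes h s) = ringRes h (idealPow.val s) := rfl

lemma IsLocalParameter.secRes_gen (hz : IsLocalParameter n V z) (k : ℕ) {U W : Y.Opens}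
    (hU : U ≤ V) (h : W ≤ U) : secRes h (hz.gen k hU) = hz.gen k (h.trans hU) := by
  apply idealPow.val_injective
  rw [idealPow.val_secRes, hz.val_gen, hz.val_gen, map_pow, ringRes_ringRes]

lemma IsLocalParameter.exists_local_eq_smul_gen (hz : IsLocalParameter n V z) (k : ℕ)
    {U : Y.Opens} (hU : U ≤ V) (s : Γ(idealPow Y k, U)) {x : Y} (hx : x ∈ U) :
    ∃ (W : Y.Opens) (h : W ≤ U) (c : Γ(Y, W)), x ∈ W ∧
      secRes h s = c • hz.gen k (h.trans hU) := by
  have hs : (firstFiltration (structureSheaf Y) k).ι.app U s ∈ _ :=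
    (firstFiltration (structureSheaf Y) k).ι_app_mem s
  rw [hz.mem_firstFiltration_iff hU] at hs
  obtain ⟨W, h, c, hxW, e⟩ := hs x hx
  let c' : Γ(Y, W) := c
  refine ⟨W, h, c', hxW, idealPow.val_injective ?_⟩
  rw [idealPow.val_smul, hz.val_gen, mul_comm]
  exact e

end LocalParameter
end MultipleCurve

end

noncomputable section

namespace MultipleCurve

universe u

/-! ### Local generators whose relations have coefficients in a power of the ideal. -/

section Frames

attribute [local instance] Abelian.hasFiniteBiproducts

variable {Y : Scheme.{u}}

/-- A finite family of sections of `M` on `U` is a frame modulo `𝓘_C ^ i` if it locally generates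
`M` and its relations have coefficients in `𝓘_C ^ i`. -/
structure IsFrame (i : ℕ) {M : Y.Modules} {U : Y.Opens} {ι : Type} [Fintype ι]
    (f : ι → Γ(M, U)) : Prop where
  exists_local_eq {W : Y.Opens} (h : W ≤ U) (s : Γ(M, W)) {x : Y} (hx : x ∈ W) :
    ∃ (W' : Y.Opens) (h' : W' ≤ W) (c : ι → Γ(Y, W')), x ∈ W' ∧
      secRes h' s = ∑ j, c j • secRes (h'.trans h) (f j)
  mem_of_sum_eq_zero {W : Y.Opens} (h : W ≤ U) (c : ι → Γ(Y, W))
    (hc : ∑ j, c j • secRes h (f j) = 0) (j : ι) :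
    c j ∈ (firstFiltration (structureSheaf Y) i).obj W

/-- `M` has a frame modulo `𝓘_C ^ i` on `U`. -/
def HasFrame (i : ℕ) (M : Y.Modules) (U : Y.Opens) : Prop :=
  ∃ (ι : Type) (_ : Fintype ι) (f : ι → Γ(M, U)), IsFrame i f

lemma IsFrame.secRes {i : ℕ} {M : Y.Modules} {U V : Y.Opens} {ι : Type} [Fintype ι]
    {f : ι → Γ(M, U)} (hf : IsFrame i f) (h : V ≤ U) : IsFrame i fun j ↦ secRes h (f j) where
  exists_local_eq h₁ s x hx := by
    simpa only [secRes_secRes] using hf.exists_local_eq (h₁.trans h) s hx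
  mem_of_sum_eq_zero h₁ c hc := by
    refine hf.mem_of_sum_eq_zero (h₁.trans h) c ?_
    simpa only [secRes_secRes] using hc

lemma HasFrame.mono {i : ℕ} {M : Y.Modules} {U V : Y.Opens} (hM : HasFrame i M U) (h : V ≤ U) :
    HasFrame i M V := by
  obtain ⟨ι, _, f, hf⟩ := hM
  exact ⟨ι, _, _, hf.secRes h⟩

/-- Finitely many local choices can be made on one common neighbourhood, for conditions stable under
shrinking. -/
lemma exists_opens_of_fintype {ι : Type} [Fintype ι] {x : Y} {U : Y.Opens} (hx : x ∈ U)
    (P : ι → ∀ V : Y.Opens, V ≤ U → Prop)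
    (hP : ∀ j V (hV : V ≤ U) W (hW : W ≤ V), P j V hV → P j W (hW.trans hV))
    (h : ∀ j, ∃ (V : Y.Opens) (hV : V ≤ U), x ∈ V ∧ P j V hV) :
    ∃ (V : Y.Opens) (hV : V ≤ U), x ∈ V ∧ ∀ j, P j V hV := by
  classical
  choose V hV hxV hPV using h
  have key (s : Finset ι) : ∃ (V : Y.Opens) (hV : V ≤ U), x ∈ V ∧ ∀ j ∈ s, P j V hV := by
    induction s using Finset.induction_on with
    | empty => exact ⟨U, le_rfl, hx, by simp⟩
    | insert a s _ ih =>
      obtain ⟨W, hW, hxW, hs⟩ := ih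
      refine ⟨V a ⊓ W, inf_le_right.trans hW, ⟨hxV a, hxW⟩, fun j hj ↦ ?_⟩
      obtain rfl | hj := Finset.mem_insert.mp hj
      · exact hP j (V j) (hV j) _ inf_le_left (hPV j)
      · exact hP j W hW _ inf_le_right (hs j hj)
  obtain ⟨W, hW, hxW, hs⟩ := key Finset.univ
  exact ⟨W, hW, hxW, fun j ↦ hs j (Finset.mem_univ j)⟩

variable (Y) in
/-- The section `1` of the structure sheaf. -/
def oneSec : Γ(structureSheaf Y, ⊤) := (1 : Γ(Y, ⊤))

lemma exists_eq_smul_oneSec {W : Y.Opens} (s : Γ(structureSheaf Y, W)) :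
    ∃ c : Γ(Y, W), s = c • secRes le_top (oneSec Y) := by
  let c : Γ(Y, W) := s
  refine ⟨c, ?_⟩
  have e : ringRes (le_top : W ≤ ⊤) (1 : Γ(Y, ⊤)) = 1 := map_one _
  exact ((congrArg (c * ·) e).trans (mul_one c)).symm

lemma smul_oneSec {W : Y.Opens} (c : Γ(Y, W)) :
    c • secRes le_top (oneSec Y) = c := by
  have e : ringRes (le_top : W ≤ ⊤) (1 : Γ(Y, ⊤)) = 1 := map_one _
  exact (congrArg (c * ·) e).trans (mul_one c)

lemma hasFrame_structureSheaf (i : ℕ) : HasFrame i (structureSheaf Y) ⊤ := by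
  refine ⟨Unit, inferInstance, fun _ ↦ oneSec Y, ⟨fun {W} h s x hx ↦ ?_, fun {W} h c hc j ↦ ?_⟩⟩
  · obtain ⟨c, hc⟩ := exists_eq_smul_oneSec s
    refine ⟨W, le_rfl, fun _ ↦ c, hx, ?_⟩
    rw [Finset.univ_unique, Finset.sum_singleton, secRes_self]
    exact hc
  · rw [Finset.univ_unique, Finset.sum_singleton] at hc
    have : c j = 0 := (smul_oneSec (c j)).symm.trans hc
    rw [this]
    exact zero_mem _

/-- The class of 1 is killed exactly by the `k`-th power of the ideal. This summand is the reason
why frames allow nonzero relations. -/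
lemma hasFrame_restrictTo (k : ℕ) : HasFrame k (restrictTo (structureSheaf Y) k) ⊤ := by
  refine ⟨Unit, inferInstance, fun _ ↦ (toRestrict (structureSheaf Y) k).app ⊤ (oneSec Y),
    ⟨fun {W} h s x hx ↦ ?_, fun {W} h c hc j ↦ ?_⟩⟩
  · have : Epi (toRestrict (structureSheaf Y) k) := inferInstanceAs (Epi (cokernel.π _))
    obtain ⟨W', h', m, hxW', e⟩ := exists_local_preimage (toRestrict (structureSheaf Y) k) s hx
    obtain ⟨c, rfl⟩ := exists_eq_smul_oneSec m
    refine ⟨W', h', fun _ ↦ c, hxW', ?_⟩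
    rw [Finset.univ_unique, Finset.sum_singleton, ← e, Scheme.Modules.Hom.app_smul, app_secRes]
  · rw [Finset.univ_unique, Finset.sum_singleton, ← app_secRes,
      ← Scheme.Modules.Hom.app_smul] at hc
    have := (Subsheaf.cokernel_π_eq_zero_iff _ _).mp hc
    have e : c j • MultipleCurve.secRes h (oneSec Y) = c j := smul_oneSec (c j)
    rw [← e]
    exact this

/-- Frames can be transported along isomorphisms of restrictions. -/
lemma HasFrame.of_sectionEquiv {i : ℕ} {M N : Y.Modules} {U : Y.Opens} (hM : HasFrame i M U)
    (e : ∀ W ≤ U, Γ(M, W) ≃ₗ[Γ(Y, W)] Γ(N, W))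
    (he : ∀ (W : Y.Opens) (hW : W ≤ U) (W' : Y.Opens) (h : W' ≤ W) (s : Γ(M, W)),
      e W' (h.trans hW) (MultipleCurve.secRes h s) = MultipleCurve.secRes h (e W hW s)) :
    HasFrame i N U := by
  obtain ⟨ι, _, f, hf⟩ := hM
  refine ⟨ι, _, fun j ↦ e U le_rfl (f j), ⟨fun {W} h s x hx ↦ ?_, fun {W} h c hc j ↦ ?_⟩⟩
  · obtain ⟨W', h', c, hxW', hc⟩ := hf.exists_local_eq h ((e W h).symm s) hx
    refine ⟨W', h', c, hxW', ?_⟩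
    have := congrArg (e W' (h'.trans h)) hc
    rw [he W h, LinearEquiv.apply_symm_apply, map_sum] at this
    rw [this]
    refine Finset.sum_congr rfl fun j _ ↦ ?_
    rw [map_smul, he U le_rfl]
  · refine hf.mem_of_sum_eq_zero h c ((e W h).injective ?_) j
    rw [map_sum, map_zero, ← hc]
    refine Finset.sum_congr rfl fun j _ ↦ ?_
    rw [map_smul, he U le_rfl]

/-- The linear map on sections induced by a morphism. -/
def appLinear {M N : Y.Modules} (f : M ⟶ N) (U : Y.Opens) : Γ(M, U) →ₗ[Γ(Y, U)] Γ(N, U) where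
  toFun := f.app U
  map_add' := map_add _
  map_smul' := Scheme.Modules.Hom.app_smul f

lemma HasFrame.of_iso {i : ℕ} {M N : Y.Modules} {U : Y.Opens} (hM : HasFrame i M U)
    (e : M ≅ N) : HasFrame i N U :=
  hM.of_sectionEquiv (fun W _ ↦ LinearEquiv.ofLinearMap (appLinear e.hom W) (appLinear e.inv W)
    (by ext s; exact congr(($e.inv_hom_id).app W s)) (by ext s; exact congr(($e.hom_inv_id).app W s)))
    (fun W _ W' h s ↦ app_secRes e.hom h s)

/-- The sections of the restriction of a morphism. -/
def restrictLinear {M N : Y.Modules} {U : Y.Opens} (f : M.restrict U.ι ⟶ N.restrict U.ι)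
    {W : Y.Opens} (h : W ≤ U) : Γ(M, W) →ₗ[Γ(Y, W)] Γ(N, W) :=
  -- This open set equals `W` only propositionally, so the map is conjugated by the restrictions
  -- along both inclusions.
  have h₁ : U.ι ''ᵁ (U.ι ⁻¹ᵁ W) ≤ W := Scheme.Hom.image_preimage_le _ _
  have h₂ : W ≤ U.ι ''ᵁ (U.ι ⁻¹ᵁ W) := by
    rw [Scheme.Hom.image_preimage_eq_opensRange_inf, Scheme.Opens.opensRange_ι]
    exact le_inf h le_rfl
  let g : Γ(M, U.ι ''ᵁ (U.ι ⁻¹ᵁ W)) →+ Γ(N, U.ι ''ᵁ (U.ι ⁻¹ᵁ W)) := (f.app (U.ι ⁻¹ᵁ W)).hom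
  { toFun s := secRes h₂ (g (secRes h₁ s))
    map_add' := fun s t ↦ by rw [map_add, map_add, map_add]
    map_smul' := fun a s ↦ by
      let b := ringRes h₁ a
      -- A morphism of restricted modules is linear over the ring of the open subscheme, so the
      -- scalar is carried there and back.
      have hb : (U.ι.appIso (U.ι ⁻¹ᵁ W)).inv ((U.ι.appIso (U.ι ⁻¹ᵁ W)).hom b) = b :=
        congr($((U.ι.appIso (U.ι ⁻¹ᵁ W)).hom_inv_id) b)
      have e : g ((U.ι.appIso (U.ι ⁻¹ᵁ W)).inv ((U.ι.appIso (U.ι ⁻¹ᵁ W)).hom b) • secRes h₁ s) =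
          (U.ι.appIso (U.ι ⁻¹ᵁ W)).inv ((U.ι.appIso (U.ι ⁻¹ᵁ W)).hom b) • g (secRes h₁ s) :=
        Scheme.Modules.Hom.app_smul f (U := U.ι ⁻¹ᵁ W) _ _
      rw [hb] at e
      rw [secRes_smul, e, secRes_smul, ringRes_ringRes, ringRes_self]
      rfl }

lemma restrictLinear_comp_apply {M N : Y.Modules} {U : Y.Opens} (f : M.restrict U.ι ⟶ N.restrict U.ι)
    (g : N.restrict U.ι ⟶ M.restrict U.ι) (hfg : f ≫ g = 𝟙 _)
    {W : Y.Opens} (h : W ≤ U) (s : Γ(M, W)) :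
    restrictLinear g h (restrictLinear f h s) = s := by
  have h₁ : U.ι ''ᵁ (U.ι ⁻¹ᵁ W) ≤ W := Scheme.Hom.image_preimage_le _ _
  have h₂ : W ≤ U.ι ''ᵁ (U.ι ⁻¹ᵁ W) := by
    rw [Scheme.Hom.image_preimage_eq_opensRange_inf, Scheme.Opens.opensRange_ι]
    exact le_inf h le_rfl
  let F : Γ(M, U.ι ''ᵁ (U.ι ⁻¹ᵁ W)) →+ Γ(N, U.ι ''ᵁ (U.ι ⁻¹ᵁ W)) := (f.app (U.ι ⁻¹ᵁ W)).hom
  let G : Γ(N, U.ι ''ᵁ (U.ι ⁻¹ᵁ W)) →+ Γ(M, U.ι ''ᵁ (U.ι ⁻¹ᵁ W)) := (g.app (U.ι ⁻¹ᵁ W)).hom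
  have key (t : Γ(M, U.ι ''ᵁ (U.ι ⁻¹ᵁ W))) : G (F t) = t := congr(($hfg).app (U.ι ⁻¹ᵁ W) t)
  change secRes h₂ (G (secRes h₁ (secRes h₂ (F (secRes h₁ s))))) = s
  rw [secRes_secRes, secRes_self, key, secRes_secRes, secRes_self]

lemma restrictLinear_secRes {M N : Y.Modules} {U : Y.Opens} (f : M.restrict U.ι ⟶ N.restrict U.ι)
    {W W' : Y.Opens} (h : W ≤ U) (h' : W' ≤ W) (s : Γ(M, W)) :
    restrictLinear f (h'.trans h) (secRes h' s) = secRes h' (restrictLinear f h s) := by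
  have h₁ (W : Y.Opens) : U.ι ''ᵁ (U.ι ⁻¹ᵁ W) ≤ W := Scheme.Hom.image_preimage_le _ _
  have h₂ {W : Y.Opens} (h : W ≤ U) : W ≤ U.ι ''ᵁ (U.ι ⁻¹ᵁ W) := by
    rw [Scheme.Hom.image_preimage_eq_opensRange_inf, Scheme.Opens.opensRange_ι]
    exact le_inf h le_rfl
  let F (W : Y.Opens) : Γ(M, U.ι ''ᵁ (U.ι ⁻¹ᵁ W)) →+ Γ(N, U.ι ''ᵁ (U.ι ⁻¹ᵁ W)) :=
    (f.app (U.ι ⁻¹ᵁ W)).hom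
  have h₃ : U.ι ''ᵁ (U.ι ⁻¹ᵁ W') ≤ U.ι ''ᵁ (U.ι ⁻¹ᵁ W) :=
    U.ι.image_mono (U.ι.preimage_mono h')
  have key (t : Γ(M, U.ι ''ᵁ (U.ι ⁻¹ᵁ W))) : F W' (secRes h₃ t) = secRes h₃ (F W t) :=
    app_secRes f (U.ι.preimage_mono h') t
  change secRes (h₂ (h'.trans h)) (F W' (secRes (h₁ W') (secRes h' s))) =
    secRes h' (secRes (h₂ h) (F W (secRes (h₁ W) s)))
  have := key (secRes (h₁ W) s)
  rw [secRes_secRes] at this ⊢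
  rw [this, secRes_secRes, secRes_secRes]

lemma HasFrame.of_restrict_iso {i : ℕ} {M N : Y.Modules} {U : Y.Opens} (hM : HasFrame i M U)
    (e : M.restrict U.ι ≅ N.restrict U.ι) : HasFrame i N U :=
  hM.of_sectionEquiv (fun W h ↦ LinearEquiv.ofLinearMap (restrictLinear e.hom h)
      (restrictLinear e.inv h)
      (by ext s; exact restrictLinear_comp_apply e.inv e.hom e.inv_hom_id h s)
      (by ext s; exact restrictLinear_comp_apply e.hom e.inv e.hom_inv_id h s))
    (fun W h W' h' s ↦ restrictLinear_secRes e.hom h h' s)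

lemma sum_app_apply {α : Type*} {M N : Y.Modules} (f : α → (M ⟶ N)) (A : Finset α)
    (U : Y.Opens) (s : Γ(M, U)) : (∑ a ∈ A, f a).app U s = ∑ a ∈ A, (f a).app U s := by
  classical
  induction A using Finset.induction_on with
  | empty => rfl
  | insert a A ha ih =>
    rw [Finset.sum_insert ha, Finset.sum_insert ha, ← ih]
    rfl

/-- The union of the frames works: generation follows from the decomposition of the identity, and a
relation projects to a relation in each summand. -/
lemma HasFrame.biproduct {i : ℕ} {α : Type} [Fintype α] {X : α → Y.Modules} {U : Y.Opens}
    (hX : ∀ a, HasFrame i (X a) U) : HasFrame i (⨁ X) U := by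
  classical
  choose ι hι f hf using hX
  refine ⟨Σ a, ι a, inferInstance, fun j ↦ (biproduct.ι X j.1).app U (f j.1 j.2),
    ⟨fun {W} h s x hx ↦ ?_, fun {W} h c hc j ↦ ?_⟩⟩
  · obtain ⟨W', h', hxW', H⟩ := exists_opens_of_fintype hx
      (fun a W' h' ↦ ∃ c : ι a → Γ(Y, W'), MultipleCurve.secRes h' ((biproduct.π X a).app W s) =
        ∑ j, c j • MultipleCurve.secRes (h'.trans h) (f a j)) (fun a V hV V' hV' ⟨c, hc⟩ ↦
          ⟨fun j ↦ ringRes hV' (c j), by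
            rw [← secRes_secRes hV hV', hc, map_sum]
            refine Finset.sum_congr rfl fun j _ ↦ ?_
            rw [secRes_smul, secRes_secRes]⟩) (fun a ↦ by
          obtain ⟨W', h', c, hxW', hc⟩ := (hf a).exists_local_eq h ((biproduct.π X a).app W s) hx
          exact ⟨W', h', hxW', c, hc⟩)
    choose c hc using H
    refine ⟨W', h', fun j ↦ c j.1 j.2, hxW', ?_⟩
    have e : ∑ a, biproduct.π X a ≫ biproduct.ι X a = 𝟙 (⨁ X) := biproduct.total
    have e' : MultipleCurve.secRes h' s =
        (∑ a, biproduct.π X a ≫ biproduct.ι X a).app W' (MultipleCurve.secRes h' s) := by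
      rw [e]; rfl
    rw [e', sum_app_apply, Fintype.sum_sigma]
    refine Finset.sum_congr rfl fun a _ ↦ ?_
    rw [comp_app_apply, app_secRes, hc, map_sum]
    refine Finset.sum_congr rfl fun j _ ↦ ?_
    rw [Scheme.Modules.Hom.app_smul, app_secRes]
  · obtain ⟨a, j⟩ := j
    refine (hf a).mem_of_sum_eq_zero h (fun j ↦ c ⟨a, j⟩) ?_ j
    have := congrArg ((biproduct.π X a).app W) hc
    rw [map_zero, map_sum, Fintype.sum_sigma, Finset.sum_eq_single a] at this
    · rw [← this]
      refine Finset.sum_congr rfl fun j _ ↦ ?_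
      rw [Scheme.Modules.Hom.app_smul, app_secRes, ← comp_app_apply, biproduct.ι_π_self]
      rfl
    · intro b _ hb
      refine Finset.sum_eq_zero fun j _ ↦ ?_
      rw [Scheme.Modules.Hom.app_smul, app_secRes, ← comp_app_apply, biproduct.ι_π_ne _ hb]
      exact (congrArg _ (map_zero _)).trans (smul_zero _)
    · simp

lemma HasFrame.sigma {i : ℕ} {r : ℕ} {X : Fin r → Y.Modules} {U : Y.Opens}
    (hX : ∀ a, HasFrame i (X a) U) : HasFrame i (∐ X) U :=
  (HasFrame.biproduct hX).of_iso (biproduct.isoCoproduct X)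

lemma HasFrame.coprod {i : ℕ} {M N : Y.Modules} {U : Y.Opens}
    (hM : HasFrame i M U) (hN : HasFrame i N U) : HasFrame i (M ⨿ N) U := by
  let X : Bool → Y.Modules := fun b ↦ bif b then M else N
  have hX : ∀ b, HasFrame i (X b) U := fun b ↦ by cases b; exacts [hN, hM]
  let e : (⨁ X) ≅ M ⨿ N :=
    { hom := biproduct.desc fun b ↦ match b with
        | true => coprod.inl
        | false => coprod.inr
      inv := coprod.desc (biproduct.ι X true) (biproduct.ι X false)
      hom_inv_id := by
        apply biproduct.hom_ext'
        rintro (_ | _)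
        · rw [biproduct.ι_desc_assoc, Category.comp_id]
          exact coprod.inr_desc _ _
        · rw [biproduct.ι_desc_assoc, Category.comp_id]
          exact coprod.inl_desc _ _
      inv_hom_id := by
        apply coprod.hom_ext
        · rw [coprod.inl_desc_assoc, biproduct.ι_desc, Category.comp_id]
          rfl
        · rw [coprod.inr_desc_assoc, biproduct.ι_desc, Category.comp_id]
          rfl }
  exact (HasFrame.biproduct hX).of_iso e

lemma hasFrame_quasiFreeModel (a b k : ℕ) : HasFrame k (quasiFreeModel Y a b k) ⊤ :=
  (HasFrame.sigma fun _ ↦ hasFrame_structureSheaf k).coprod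
    (HasFrame.sigma fun _ ↦ hasFrame_restrictTo k)

lemma LocallyIsomorphic.exists_hasFrame {M N : Y.Modules} (h : LocallyIsomorphic M N) {i : ℕ}
    (hN : HasFrame i N ⊤) (x : Y) : ∃ U : Y.Opens, x ∈ U ∧ HasFrame i M U := by
  obtain ⟨U, hx, ⟨e⟩⟩ := h x
  exact ⟨U, hx, (hN.mono le_top).of_restrict_iso e.symm⟩

lemma IsVectorBundle.exists_hasFrame {M : Y.Modules} (h : IsVectorBundle M) (i : ℕ) (x : Y) :
    ∃ U : Y.Opens, x ∈ U ∧ HasFrame i M U := by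
  obtain ⟨U, r, hx, ⟨e⟩⟩ := h x
  exact ⟨U, hx, ((HasFrame.sigma fun _ ↦ hasFrame_structureSheaf i).mono le_top).of_restrict_iso
    e.symm⟩

end Frames
end MultipleCurve

end

noncomputable section

namespace MultipleCurve

universe u

/-! ### Annihilators in a vector bundle, and the kernel of a surjection. -/

section KernelOfFrames

variable {Y : Scheme.{u}} {n : ℕ} {V : Y.Opens} {z : Γ(Y, V)}

lemma IsLocalParameter.ringRes_pow_eq_zero (hz : IsLocalParameter n V z) {U : Y.Opens}
    (hU : U ≤ V) : ringRes hU z ^ n = 0 := by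
  rw [← map_pow, hz.pow_eq_zero, map_zero]

lemma IsLocalParameter.eq_zero_of_mem_firstFiltration (hz : IsLocalParameter n V z)
    {M : Y.Modules} {U : Y.Opens} (hU : U ≤ V) {s : Γ(M, U)}
    (hs : s ∈ (firstFiltration M n).obj U) : s = 0 := by
  refine eq_zero_of_local _ _ fun x hx ↦ ?_
  obtain ⟨W, h, m, hxW, e⟩ := (hz.mem_firstFiltration_iff hU n s).mp hs x hx
  exact ⟨W, h, hxW, by rw [e, hz.ringRes_pow_eq_zero, zero_smul]⟩

/-- A frame modulo the `n`-th power is a true basis because z^n = 0, so the annihilator of z^k can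
be computed coordinate by coordinate. -/
lemma IsLocalParameter.exists_local_eq_of_pow_smul_eq_zero (hz : IsLocalParameter n V z)
    {M : Y.Modules} (hM : ∀ x : Y, ∃ U : Y.Opens, x ∈ U ∧ HasFrame n M U) {k : ℕ} (hk : k ≤ n)
    {W : Y.Opens} (hW : W ≤ V) (v : Γ(M, W)) (hv : ringRes hW z ^ k • v = 0) {x : Y}
    (hx : x ∈ W) : ∃ (W' : Y.Opens) (h : W' ≤ W) (w : Γ(M, W')), x ∈ W' ∧
      secRes h v = ringRes (h.trans hW) z ^ (n - k) • w := by
  obtain ⟨U, hxU, ι, _, f, hf⟩ := hM x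
  obtain ⟨W₁, h₁, c, hxW₁, hc⟩ := hf.exists_local_eq (W := W ⊓ U) inf_le_right
    (secRes inf_le_left v) ⟨hx, hxU⟩
  have hW₁ : W₁ ≤ V := h₁.trans (inf_le_left.trans hW)
  rw [secRes_secRes] at hc
  have hzero (j : ι) : ringRes hW₁ z ^ k * c j = 0 := by
    refine hz.eq_zero_of_mem_firstFiltration (M := structureSheaf Y) hW₁
      (hf.mem_of_sum_eq_zero (h₁.trans inf_le_right) (fun j ↦ ringRes hW₁ z ^ k * c j) ?_ j)
    have := congrArg (secRes (h₁.trans inf_le_left)) hv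
    rw [secRes_smul, map_zero, hc, map_pow, ringRes_ringRes, Finset.smul_sum] at this
    rw [← this]
    exact Finset.sum_congr rfl fun j _ ↦ mul_smul _ _ _
  -- The annihilator property of a local parameter is available on affine opens.
  obtain ⟨W₂, hxW₂, h₂⟩ := exists_affine Y hxW₁
  have hd (j : ι) : ∃ d, ringRes h₂ (c j) = ringRes (h₂.trans hW₁) z ^ (n - k) * d := by
    refine hz.exists_eq_of_pow_mul_eq_zero W₂ (h₂.trans hW₁) k hk _ ?_
    rw [← ringRes_ringRes hW₁ h₂, ← map_pow, ← map_mul, hzero, map_zero]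
  choose d hd using hd
  refine ⟨W₂.1, h₂.trans (h₁.trans inf_le_left), ∑ j, d j • secRes (h₂.trans (h₁.trans inf_le_right)) (f j),
    hxW₂, ?_⟩
  rw [← secRes_secRes (h₁.trans inf_le_left) h₂, hc, map_sum, Finset.smul_sum]
  refine Finset.sum_congr rfl fun j _ ↦ ?_
  rw [secRes_smul, secRes_secRes, hd, mul_smul]

lemma toRestrict_app_eq_zero_iff {M : Y.Modules} {i : ℕ} {U : Y.Opens} (s : Γ(M, U)) :
    (toRestrict M i).app U s = 0 ↔ s ∈ (firstFiltration M i).obj U :=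
  Subsheaf.cokernel_π_eq_zero_iff _ _

lemma toFiltrationQuotient_app_eq_zero_iff {k : ℕ} (hn : Y.nilradical ^ n = ⊥) (hk : k ≤ n)
    {M : Y.Modules} {U : Y.Opens} (u : Γ((secondFiltration M k).toModules, U)) :
    (toFiltrationQuotient hn hk M).app U u = 0 ↔
      (secondFiltration M k).ι.app U u ∈ (firstFiltration M (n - k)).obj U :=
  Subsheaf.cokernel_π_homOfLE_eq_zero_iff _ _

instance epi_toRestrict (M : Y.Modules) (i : ℕ) : Epi (toRestrict M i) :=
  inferInstanceAs (Epi (cokernel.π _))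

instance epi_toFiltrationQuotient {k : ℕ} (hn : Y.nilradical ^ n = ⊥) (hk : k ≤ n)
    (M : Y.Modules) : Epi (toFiltrationQuotient hn hk M) :=
  inferInstanceAs (Epi (cokernel.π _))

/-- This extracts all that is needed from the isomorphism on C: the kernel of `φ` is contained in
I_C E. -/
lemma mem_firstFiltration_one_of_app_eq_zero {E F : Y.Modules} (φ : E ⟶ F)
    (ψ : restrictTo E 1 ≅ restrictTo F 1) (hψ : toRestrict E 1 ≫ ψ.hom = φ ≫ toRestrict F 1)
    {W : Y.Opens} (m : Γ(E, W)) (hm : φ.app W m = 0) : m ∈ (firstFiltration E 1).obj W := by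
  refine (toRestrict_app_eq_zero_iff m).mp (app_injective_of_mono ψ.hom W ?_)
  rw [map_zero]
  change (toRestrict E 1 ≫ ψ.hom).app W m = 0
  rw [hψ, comp_app_apply, hm, map_zero]

/-- If the kernel of `φ` is contained in `𝓘_C E`, and if the target has local frames modulo
`𝓘_C ^ k`, then the kernel is contained in `𝓘_C ^ k E`. -/
lemma IsLocalParameter.exists_local_eq_of_app_eq_zero (hz : IsLocalParameter n V z)
    {E F : Y.Modules} (φ : E ⟶ F) [Epi φ] {k : ℕ}
    (hF : ∀ x : Y, ∃ U : Y.Opens, x ∈ U ∧ HasFrame k F U)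
    (hφ : ∀ {W : Y.Opens} (m : Γ(E, W)), φ.app W m = 0 → m ∈ (firstFiltration E 1).obj W)
    {W : Y.Opens} (hW : W ≤ V) (l : Γ(E, W)) (hl : φ.app W l = 0) {x : Y} (hx : x ∈ W) :
    ∃ (W' : Y.Opens) (h : W' ≤ W) (v : Γ(E, W')), x ∈ W' ∧
      secRes h l = ringRes (h.trans hW) z ^ k • v := by
  obtain ⟨U, hxU, ι, _, f, hf⟩ := hF x
  obtain ⟨W₁, h₁, hxW₁, he⟩ := exists_opens_of_fintype (U := W ⊓ U) ⟨hx, hxU⟩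
    (fun j W₁ h₁ ↦ ∃ e : Γ(E, W₁), φ.app W₁ e = secRes (h₁.trans inf_le_right) (f j))
    (fun j A hA B hB ⟨e, he⟩ ↦ ⟨secRes hB e, by rw [app_secRes, he, secRes_secRes]⟩)
    (fun j ↦ by
      obtain ⟨A, hA, m, hxA, e⟩ := exists_local_preimage φ
        (secRes (inf_le_right : W ⊓ U ≤ U) (f j)) ⟨hx, hxU⟩
      exact ⟨A, hA, hxA, m, by rw [e, secRes_secRes]⟩)
  choose e he using he
  have hW₁ : W₁ ≤ V := h₁.trans (inf_le_left.trans hW)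
  -- Nakayama for a nilpotent ideal: the lifts `e` generate E modulo z^t E. In the induction step
  -- the remainder `m'` is corrected by a combination of the `e j` with the same image; the
  -- difference lies in ker φ, hence in zE.
  have key (t : ℕ) : ∀ {A : Y.Opens} (hA : A ≤ W₁) (m : Γ(E, A)) {y : Y}, y ∈ A →
      ∃ (B : Y.Opens) (hB : B ≤ A) (a : ι → Γ(Y, B)) (m' : Γ(E, B)), y ∈ B ∧
        secRes hB m = ∑ j, a j • secRes (hB.trans hA) (e j) +
          ringRes (hB.trans (hA.trans hW₁)) z ^ t • m' := by
    induction t with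
    | zero =>
      intro A hA m y hy
      refine ⟨A, le_rfl, 0, m, hy, ?_⟩
      simp
    | succ t ih =>
      intro A hA m y hy
      obtain ⟨B, hB, a, m', hyB, hm⟩ := ih hA m hy
      obtain ⟨B₁, hB₁, b, hyB₁, hb⟩ := hf.exists_local_eq
        ((hB.trans hA).trans (h₁.trans inf_le_right)) (φ.app B m') hyB
      have hzero : φ.app B₁ (secRes hB₁ m' -
          ∑ j, b j • secRes (hB₁.trans (hB.trans hA)) (e j)) = 0 := by
        rw [map_sub, app_secRes, hb, map_sum, sub_eq_zero]
        refine Finset.sum_congr rfl fun j _ ↦ ?_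
        rw [Scheme.Modules.Hom.app_smul, app_secRes, he, secRes_secRes]
      obtain ⟨B₂, hB₂, w, hyB₂, hw⟩ := (hz.mem_firstFiltration_iff
        (hB₁.trans ((hB.trans hA).trans hW₁)) 1 _).mp (hφ _ hzero) y hyB₁
      refine ⟨B₂, hB₂.trans (hB₁.trans hB), fun j ↦ ringRes (hB₂.trans hB₁) (a j) +
        ringRes (hB₂.trans (hB₁.trans ((hB.trans hA).trans hW₁))) z ^ t * ringRes hB₂ (b j), w,
        hyB₂, ?_⟩
      rw [pow_one, map_sub, sub_eq_iff_eq_add, secRes_secRes] at hw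
      rw [← secRes_secRes hB (hB₂.trans hB₁), hm, map_add, secRes_smul, hw, map_sum, map_sum,
        smul_add, map_pow, ringRes_ringRes, pow_succ, mul_smul, add_comm (_ • _ • w), ← add_assoc]
      congr 1
      rw [Finset.smul_sum, ← Finset.sum_add_distrib]
      refine Finset.sum_congr rfl fun j _ ↦ ?_
      rw [secRes_smul, secRes_secRes, secRes_smul, secRes_secRes, add_smul, mul_smul]
  -- For `t = n` the remainder vanishes, so `l` is a combination of the `e j`. Applying `φ` gives a
  -- relation between the `f j`, which forces the coefficients into the `k`-th power of the ideal.
  obtain ⟨A, hA, a, m', hxA, hm⟩ := key n le_rfl (secRes (h₁.trans inf_le_left) l) hxW₁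
  rw [hz.ringRes_pow_eq_zero, zero_smul, add_zero, secRes_secRes] at hm
  have ha : ∑ j, a j • secRes (hA.trans (h₁.trans inf_le_right)) (f j) = 0 := by
    have := congrArg (φ.app A) hm
    rw [app_secRes, hl, map_zero, map_sum] at this
    rw [this]
    refine Finset.sum_congr rfl fun j _ ↦ ?_
    rw [Scheme.Modules.Hom.app_smul, app_secRes, he, secRes_secRes]
  have hmem := hf.mem_of_sum_eq_zero (hA.trans (h₁.trans inf_le_right)) a ha
  obtain ⟨B, hB, hxB, hb⟩ := exists_opens_of_fintype hxA
    (fun j B hB ↦ ∃ b : Γ(Y, B), ringRes hB (a j) = ringRes (hB.trans (hA.trans hW₁)) z ^ k * b)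
    (fun j B hB B' hB' ⟨b, hb⟩ ↦ ⟨ringRes hB' b, by
      rw [← ringRes_ringRes hB hB', hb, map_mul, map_pow, ringRes_ringRes]⟩)
    (fun j ↦ by
      obtain ⟨B, hB, b, hxB, hb⟩ :=
        (hz.mem_firstFiltration_iff (hA.trans hW₁) k _).mp (hmem j) x hxA
      exact ⟨B, hB, hxB, b, hb⟩)
  choose b hb using hb
  refine ⟨B, hB.trans (hA.trans (h₁.trans inf_le_left)),
    ∑ j, b j • secRes (hB.trans hA) (e j), hxB, ?_⟩
  rw [← secRes_secRes (hA.trans (h₁.trans inf_le_left)) hB, hm, map_sum, Finset.smul_sum]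
  refine Finset.sum_congr rfl fun j _ ↦ ?_
  rw [secRes_smul, secRes_secRes, hb, mul_smul]

end KernelOfFrames
end MultipleCurve

end

noncomputable section

open scoped TensorProduct

namespace MultipleCurve

universe u

/-! ### The relation whose graph is the comparison morphism. -/

section Comparison

variable {Y : Scheme.{u}} {n k : ℕ} (hn : Y.nilradical ^ n = ⊥) (hk : k ≤ n)
  {E F : Y.Modules} (φ : E ⟶ F)

/-- The relation between the sections `l` of `ker φ` and `t` of `(F^(k) / F_{n-k}) ⊗ 𝓘_C ^ k`:
locally `l = s v` and `t = [φ v] ⊗ s`. -/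
def ComparisonRel (U : Y.Opens) (l : Γ(kernel φ, U))
    (t : Γ(tensor (filtrationQuotient hn hk F) (idealPow Y k), U)) : Prop :=
  ∀ x ∈ U, ∃ (W : Y.Opens) (h : W ≤ U) (u : Γ((secondFiltration F k).toModules, W))
    (s : Γ(idealPow Y k, W)) (v : Γ(E, W)), x ∈ W ∧
      φ.app W v = (secondFiltration F k).ι.app W u ∧
      (kernel.ι φ).app W (secRes h l) = idealPow.val s • v ∧
      secRes h t = tmul ((toFiltrationQuotient hn hk F).app W u) s

variable {hn hk φ}

lemma ComparisonRel.res {U V : Y.Opens} (h : V ≤ U) {l : Γ(kernel φ, U)}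
    {t : Γ(tensor (filtrationQuotient hn hk F) (idealPow Y k), U)}
    (H : ComparisonRel hn hk φ U l t) : ComparisonRel hn hk φ V (secRes h l) (secRes h t) := by
  intro x hx
  obtain ⟨W, hW, u, s, v, hxW, h₁, h₂, h₃⟩ := H x (h hx)
  let i : W ⊓ V ≤ W := inf_le_left
  refine ⟨W ⊓ V, inf_le_right, secRes i u, secRes i s, secRes i v, ⟨hxW, hx⟩, ?_, ?_, ?_⟩
  · rw [app_secRes, h₁, app_secRes]
  · rw [secRes_secRes, ← secRes_secRes hW i, app_secRes, h₂, secRes_smul, idealPow.val_secRes]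
  · rw [secRes_secRes, ← secRes_secRes hW i, h₃, secRes_tmul, app_secRes]

lemma ComparisonRel.loc {U : Y.Opens} {l : Γ(kernel φ, U)}
    {t : Γ(tensor (filtrationQuotient hn hk F) (idealPow Y k), U)}
    (H : ∀ x ∈ U, ∃ (V : Y.Opens) (h : V ≤ U), x ∈ V ∧
      ComparisonRel hn hk φ V (secRes h l) (secRes h t)) : ComparisonRel hn hk φ U l t := by
  intro x hx
  obtain ⟨V, hV, hxV, H⟩ := H x hx
  obtain ⟨W, hW, u, s, v, hxW, h₁, h₂, h₃⟩ := H x hxV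
  refine ⟨W, hW.trans hV, u, s, v, hxW, h₁, ?_, ?_⟩
  · rw [← h₂, secRes_secRes]
  · rw [← h₃, secRes_secRes]

lemma ComparisonRel.smul {U : Y.Opens} (a : Γ(Y, U)) {l : Γ(kernel φ, U)}
    {t : Γ(tensor (filtrationQuotient hn hk F) (idealPow Y k), U)}
    (H : ComparisonRel hn hk φ U l t) : ComparisonRel hn hk φ U (a • l) (a • t) := by
  intro x hx
  obtain ⟨W, hW, u, s, v, hxW, h₁, h₂, h₃⟩ := H x hx
  refine ⟨W, hW, ringRes hW a • u, s, ringRes hW a • v, hxW, ?_, ?_, ?_⟩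
  · rw [Scheme.Modules.Hom.app_smul, h₁, Scheme.Modules.Hom.app_smul]
  · rw [secRes_smul, Scheme.Modules.Hom.app_smul, h₂, smul_comm]
  · rw [secRes_smul, h₃, Scheme.Modules.Hom.app_smul, smul_tmul']

/-- Writing s = c z^k, the coefficient c is absorbed by `u` and `v`. With `s` normalized to z^k, two
local representations share their second tensor factor and can be added. -/
lemma ComparisonRel.exists_local {V : Y.Opens} {z : Γ(Y, V)} (hz : IsLocalParameter n V z)
    {U : Y.Opens} {l : Γ(kernel φ, U)}
    {t : Γ(tensor (filtrationQuotient hn hk F) (idealPow Y k), U)}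
    (H : ComparisonRel hn hk φ U l t) {x : Y} (hx : x ∈ U) (hxV : x ∈ V) :
    ∃ (W : Y.Opens) (h : W ≤ U) (hW : W ≤ V) (u : Γ((secondFiltration F k).toModules, W))
      (v : Γ(E, W)), x ∈ W ∧ φ.app W v = (secondFiltration F k).ι.app W u ∧
      (kernel.ι φ).app W (secRes h l) = ringRes hW z ^ k • v ∧
      secRes h t = tmul ((toFiltrationQuotient hn hk F).app W u) (hz.gen k hW) := by
  obtain ⟨A, hA, u, s, v, hxA, h₁, h₂, h₃⟩ := (H.res (inf_le_left : U ⊓ V ≤ U)) x ⟨hx, hxV⟩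
  have hAV : A ≤ V := hA.trans inf_le_right
  obtain ⟨W, hW, c, hxW, hs⟩ := hz.exists_local_eq_smul_gen k hAV s hxA
  have hs' : ringRes hW (idealPow.val s) = c * ringRes (hW.trans hAV) z ^ k := by
    rw [← idealPow.val_secRes, hs, idealPow.val_smul, hz.val_gen]
  refine ⟨W, hW.trans (hA.trans inf_le_left), hW.trans hAV, c • secRes hW u, c • secRes hW v, hxW,
    ?_, ?_, ?_⟩
  · rw [Scheme.Modules.Hom.app_smul, app_secRes, h₁, Scheme.Modules.Hom.app_smul, app_secRes]
  · have := congrArg (secRes hW) h₂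
    rw [← app_secRes, secRes_smul, secRes_secRes, secRes_secRes, hs'] at this
    rw [this, smul_smul, mul_comm]
  · have := congrArg (secRes hW) h₃
    rw [secRes_tmul, hs, tmul_smul, ← app_secRes, ← Scheme.Modules.Hom.app_smul, secRes_secRes,
      secRes_secRes] at this
    exact this

lemma ComparisonRel.add (hpar : ∀ x : Y, ∃ (V : Y.Opens) (z : Γ(Y, V)), x ∈ V ∧
      IsLocalParameter n V z) {U : Y.Opens} {l l' : Γ(kernel φ, U)}
    {t t' : Γ(tensor (filtrationQuotient hn hk F) (idealPow Y k), U)}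
    (H : ComparisonRel hn hk φ U l t) (H' : ComparisonRel hn hk φ U l' t') :
    ComparisonRel hn hk φ U (l + l') (t + t') := by
  intro x hx
  obtain ⟨V, z, hxV, hz⟩ := hpar x
  obtain ⟨A, hA, hAV, u, v, hxA, h₁, h₂, h₃⟩ := H.exists_local hz hx hxV
  obtain ⟨W, hW, hWV, u', v', hxW, h₁', h₂', h₃'⟩ := (H'.res hA).exists_local hz hxA hxV
  refine ⟨W, hW.trans hA, secRes hW u + u', hz.gen k hWV, secRes hW v + v', hxW, ?_, ?_, ?_⟩
  · rw [map_add, map_add, h₁', app_secRes, h₁, app_secRes]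
  · have := congrArg (secRes hW) h₂
    rw [← app_secRes, secRes_smul, secRes_secRes, map_pow, ringRes_ringRes] at this
    rw [secRes_secRes] at h₂'
    rw [map_add, map_add, h₂', this, hz.val_gen, smul_add]
  · have := congrArg (secRes hW) h₃
    rw [secRes_tmul, hz.secRes_gen, ← app_secRes, secRes_secRes] at this
    rw [secRes_secRes] at h₃'
    rw [map_add, map_add, h₃', this, add_tmul]

/-- Well-definedness: z^k v = 0 forces v ∈ z^(n-k) E, so φ(v) lies in F_{n-k} and its class is zero.
-/
lemma ComparisonRel.eq_zero (hpar : ∀ x : Y, ∃ (V : Y.Opens) (z : Γ(Y, V)), x ∈ V ∧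
      IsLocalParameter n V z) (hE : ∀ x : Y, ∃ U : Y.Opens, x ∈ U ∧ HasFrame n E U) {U : Y.Opens}
    {t : Γ(tensor (filtrationQuotient hn hk F) (idealPow Y k), U)}
    (H : ComparisonRel hn hk φ U 0 t) : t = 0 := by
  refine eq_zero_of_local _ _ fun x hx ↦ ?_
  obtain ⟨V, z, hxV, hz⟩ := hpar x
  obtain ⟨A, hA, hAV, u, v, hxA, h₁, h₂, h₃⟩ := H.exists_local hz hx hxV
  rw [map_zero, map_zero] at h₂
  obtain ⟨W, hW, w, hxW, hw⟩ := hz.exists_local_eq_of_pow_smul_eq_zero hE hk hAV v h₂.symm hxA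
  refine ⟨W, hW.trans hA, hxW, ?_⟩
  have hu : (toFiltrationQuotient hn hk F).app W (secRes hW u) = 0 := by
    rw [toFiltrationQuotient_app_eq_zero_iff, hz.mem_firstFiltration_iff (hW.trans hAV)]
    intro y hy
    refine ⟨W, le_rfl, φ.app W w, hy, ?_⟩
    rw [secRes_self, app_secRes, ← h₁, ← app_secRes, hw, Scheme.Modules.Hom.app_smul]
  rw [← secRes_secRes hA hW, h₃, secRes_tmul, ← app_secRes, hu, zero_tmul]

variable (hn hk φ)

/-- Since the kernel lies in z^k E, locally l = z^k v; then z^k φ(v) = 0, so φ(v) belongs to F^(k).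
-/
lemma ComparisonRel.exists_right (hpar : ∀ x : Y, ∃ (V : Y.Opens) (z : Γ(Y, V)), x ∈ V ∧
      IsLocalParameter n V z) [Epi φ] (hF : ∀ x : Y, ∃ U : Y.Opens, x ∈ U ∧ HasFrame k F U)
    (hφ : ∀ {W : Y.Opens} (m : Γ(E, W)), φ.app W m = 0 → m ∈ (firstFiltration E 1).obj W)
    {U : Y.Opens} (l : Γ(kernel φ, U)) {x : Y} (hx : x ∈ U) :
    ∃ (W : Y.Opens) (h : W ≤ U) (t : Γ(tensor (filtrationQuotient hn hk F) (idealPow Y k), W)),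
      x ∈ W ∧ ComparisonRel hn hk φ W (secRes h l) t := by
  obtain ⟨V, z, hxV, hz⟩ := hpar x
  obtain ⟨W, hW, v, hxW, hv⟩ := hz.exists_local_eq_of_app_eq_zero φ hF hφ
    (inf_le_right : U ⊓ V ≤ V) (secRes inf_le_left ((kernel.ι φ).app U l))
    (by rw [app_secRes, app_kernel_ι_app, map_zero]) ⟨hx, hxV⟩
  have hWU : W ≤ U := hW.trans inf_le_left
  have hWV : W ≤ V := hW.trans inf_le_right
  rw [secRes_secRes] at hv
  have hmem : φ.app W v ∈ (secondFiltration F k).obj W := by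
    refine hz.mem_secondFiltration hWV k _ ?_
    rw [← Scheme.Modules.Hom.app_smul, ← hv, app_secRes, app_kernel_ι_app, map_zero]
  obtain ⟨u, hu⟩ := Subsheaf.exists_ι_app_eq _ hmem
  refine ⟨W, hWU, tmul ((toFiltrationQuotient hn hk F).app W u) (hz.gen k hWV), hxW,
    fun y hy ↦ ⟨W, le_rfl, u, hz.gen k hWV, v, hy, hu.symm, ?_, ?_⟩⟩
  · rw [secRes_self, app_secRes, hv, hz.val_gen]
  · rw [secRes_self]

end Comparison
end MultipleCurve

end

noncomputable section

open scoped TensorProduct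

namespace MultipleCurve

universe u

/-! ### The comparison morphism is an isomorphism. -/

section Comparison

variable {Y : Scheme.{u}} {n k : ℕ}

/-- Local multiples of z^k are upgraded to a multiple on the whole affine open, since membership in
an ideal of an affine ring is tested on stalks. -/
lemma IsLocalParameter.exists_eq_smul_gen {V : Y.Opens} {z : Γ(Y, V)}
    (hz : IsLocalParameter n V z) (W : Y.affineOpens) (hW : W.1 ≤ V) (s : Γ(idealPow Y k, W.1)) :
    ∃ c : Γ(Y, W.1), s = c • hz.gen k hW := by
  have hmem : idealPow.val s ∈ Ideal.span {ringRes hW z ^ k} := by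
    rw [W.2.mem_ideal_iff]
    intro x hx
    obtain ⟨A, hA, c, hxA, e⟩ := hz.exists_local_eq_smul_gen k hW s hx
    have e' := congrArg idealPow.val e
    rw [idealPow.val_secRes, idealPow.val_smul, hz.val_gen, ← ringRes_ringRes hW hA,
      ← map_pow] at e'
    have hg (a : Γ(Y, W.1)) : (Y.presheaf.germ A x hxA).hom (ringRes hA a) =
        (Y.presheaf.germ W.1 x hx).hom a :=
      TopCat.Presheaf.germ_res_apply Y.presheaf (CategoryTheory.homOfLE hA) x hxA a
    have := congrArg (Y.presheaf.germ A x hxA).hom e'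
    rw [map_mul, hg, hg] at this
    rw [this]
    exact Ideal.mul_mem_left _ _ (Ideal.mem_map_of_mem _ (Ideal.mem_span_singleton_self _))
  obtain ⟨c, hc⟩ := Ideal.mem_span_singleton'.mp hmem
  exact ⟨c, idealPow.val_injective (by rw [idealPow.val_smul, hz.val_gen, hc])⟩

/-- As z^k generates, the equational criterion for vanishing tensors writes m = Σ a_j y_j with a_j
z^k = 0, and each such a_j is a multiple of z^(n-k). -/
lemma IsLocalParameter.exists_eq_of_tmul_gen_eq_zero {V : Y.Opens} {z : Γ(Y, V)}
    (hz : IsLocalParameter n V z) (hk : k ≤ n) (W : Y.affineOpens) (hW : W.1 ≤ V) {M : Y.Modules}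
    (m : Γ(M, W.1)) (hm : m ⊗ₜ[Γ(Y, W.1)] hz.gen k hW = 0) :
    ∃ m', m = ringRes hW z ^ (n - k) • m' := by
  have hspan : Submodule.span Γ(Y, W.1) (Set.range fun _ : Unit ↦ hz.gen k hW) = ⊤ := by
    rw [eq_top_iff]
    intro s _
    obtain ⟨c, rfl⟩ := hz.exists_eq_smul_gen W hW s
    exact Submodule.smul_mem _ _ (Submodule.subset_span ⟨(), rfl⟩)
  have h0 : hz.gen k hW ⊗ₜ[Γ(Y, W.1)] m = 0 := by
    have := congrArg (TensorProduct.comm Γ(Y, W.1) _ _) hm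
    rwa [TensorProduct.comm_tmul, map_zero] at this
  obtain ⟨κ, a, y, h₁, h₂⟩ := TensorProduct.vanishesTrivially_of_sum_tmul_eq_zero Γ(Y, W.1)
    (m := fun _ : Unit ↦ hz.gen k hW) (n := fun _ ↦ m) hspan (by simpa using h0)
  have hd (j : Fin κ) : ∃ d, a () j = ringRes hW z ^ (n - k) * d := by
    refine hz.exists_eq_of_pow_mul_eq_zero W hW k hk _ ?_
    have := congrArg idealPow.val (h₂ j)
    rw [Finset.univ_unique, Finset.sum_singleton, idealPow.val_smul, hz.val_gen, mul_comm] at this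
    rw [this]
    exact map_zero _
  choose d hd using hd
  refine ⟨∑ j, d j • y j, ?_⟩
  refine (h₁ ()).trans ?_
  rw [Finset.smul_sum]
  exact Finset.sum_congr rfl fun j _ ↦ by rw [hd, mul_smul]

lemma idealPow.exists_smul_eq {M : Y.Modules} {U : Y.Opens} (s : Γ(idealPow Y k, U)) (m : Γ(M, U))
    {F : Y.Modules} (φ : M ⟶ F) (hm : φ.app U m ∈ (secondFiltration F k).obj U) :
    ∃ l : Γ(kernel φ, U), (kernel.ι φ).app U l = idealPow.val s • m := by
  apply exists_kernel_ι_app_eq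
  rw [Scheme.Modules.Hom.app_smul]
  refine eq_zero_of_local _ _ fun x hx ↦ ?_
  have hs : (firstFiltration (structureSheaf Y) k).ι.app U s ∈ _ :=
    (firstFiltration (structureSheaf Y) k).ι_app_mem s
  obtain ⟨W, i, hxW, hW⟩ := hs x hx
  refine ⟨W.1, leOfHom i, hxW, ?_⟩
  rw [secRes_smul]
  refine hm W i _ ?_
  let J := (Y.nilradical ^ k).ideal W
  have : (J • ⊤ : Submodule Γ(Y, W.1) Γ(Y, W.1)) = J := by
    rw [smul_eq_mul, Ideal.mul_top]
  exact this.le hW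

theorem existsUnique_comparison_iso (hn : Y.nilradical ^ n = ⊥) (hk : k ≤ n)
    {E F : Y.Modules} (φ : E ⟶ F) [Epi φ]
    (hpar : ∀ x : Y, ∃ (V : Y.Opens) (z : Γ(Y, V)), x ∈ V ∧ IsLocalParameter n V z)
    (hE : ∀ x : Y, ∃ U : Y.Opens, x ∈ U ∧ HasFrame n E U)
    (hF : ∀ x : Y, ∃ U : Y.Opens, x ∈ U ∧ HasFrame k F U)
    (hφ : ∀ {W : Y.Opens} (m : Γ(E, W)), φ.app W m = 0 → m ∈ (firstFiltration E 1).obj W) :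
    ∃! θ : restrictTo (kernel φ) k ≅ tensor (filtrationQuotient hn hk F) (idealPow Y k),
      ∀ (U : Y.Opens) (u : Γ((secondFiltration F k).toModules, U)) (s : Γ(idealPow Y k, U))
        (v : Γ(E, U)) (l : Γ(kernel φ, U)),
        φ.app U v = (secondFiltration F k).ι.app U u →
        (kernel.ι φ).app U l = idealPow.val s • v →
        θ.hom.app U ((toRestrict (kernel φ) k).app U l) =
          tmul ((toFiltrationQuotient hn hk F).app U u) s := by
  obtain ⟨θ₀, hθ₀⟩ := exists_hom_of_local_graph (ComparisonRel hn hk φ) ComparisonRel.res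
    ComparisonRel.loc (ComparisonRel.add hpar) ComparisonRel.smul (ComparisonRel.eq_zero hpar hE)
    fun m x hx ↦ ComparisonRel.exists_right hn hk φ hpar hF hφ m hx
  have key {U : Y.Opens} (u : Γ((secondFiltration F k).toModules, U)) (s : Γ(idealPow Y k, U))
      (v : Γ(E, U)) (l : Γ(kernel φ, U)) (h₁ : φ.app U v = (secondFiltration F k).ι.app U u)
      (h₂ : (kernel.ι φ).app U l = idealPow.val s • v) :
      θ₀.app U l = tmul ((toFiltrationQuotient hn hk F).app U u) s :=
    (hθ₀ _ _ _).mp fun x hx ↦ ⟨U, le_rfl, u, s, v, hx, h₁, by rw [secRes_self, h₂],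
      by rw [secRes_self]⟩
  -- A section z^k l' with l' in the kernel is represented by v = l', whose image under `φ` is 0.
  have w : (firstFiltration (kernel φ) k).ι ≫ θ₀ = 0 := by
    refine hom_ext_apply fun U l ↦ eq_zero_of_local _ _ fun x hx ↦ ?_
    obtain ⟨V, z, hxV, hz⟩ := hpar x
    have hl := (firstFiltration (kernel φ) k).ι_app_mem (secRes (inf_le_left : U ⊓ V ≤ U) l)
    obtain ⟨W, hW, l', hxW, e⟩ := (hz.mem_firstFiltration_iff inf_le_right k _).mp hl x ⟨hx, hxV⟩
    refine ⟨W, hW.trans inf_le_left, hxW, ?_⟩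
    rw [app_secRes, secRes_secRes] at e
    rw [comp_app_apply, ← app_secRes, e, key 0 (hz.gen k (hW.trans inf_le_right))
      ((kernel.ι φ).app W l') _ (by rw [app_kernel_ι_app, map_zero])
      (by rw [Scheme.Modules.Hom.app_smul, hz.val_gen]), map_zero, zero_tmul]
  let θ : restrictTo (kernel φ) k ⟶ tensor (filtrationQuotient hn hk F) (idealPow Y k) :=
    cokernel.desc _ θ₀ w
  have hθ : toRestrict (kernel φ) k ≫ θ = θ₀ := cokernel.π_desc _ _ _
  have hθ' {U : Y.Opens} (l : Γ(kernel φ, U)) :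
      θ.app U ((toRestrict (kernel φ) k).app U l) = θ₀.app U l := by
    rw [← comp_app_apply, hθ]
  have hmono : Mono θ := by
    refine mono_of_app_injective _ fun U ↦ (injective_iff_map_eq_zero _).mpr fun w hw ↦
      eq_zero_of_local _ _ fun x hx ↦ ?_
    obtain ⟨V, z, hxV, hz⟩ := hpar x
    obtain ⟨A, hA, l, hxA, hl⟩ := exists_local_preimage (toRestrict (kernel φ) k) w hx
    have h0 : θ₀.app A l = 0 := by
      rw [← hθ', hl, app_secRes, hw, map_zero]
    obtain ⟨B, hB, hBV, u, v, hxB, h₁, h₂, h₃⟩ :=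
      ((hθ₀ _ _ _).mpr h0).exists_local hz hxA hxV
    rw [map_zero] at h₃
    obtain ⟨C, hC, hxC, hC0⟩ := exists_local_tmul_eq_zero _ _ h₃.symm hxB
    rw [hz.secRes_gen] at hC0
    -- The class of `u` is z^(n-k) q. A lift u' of q differs from the truth by an element z^(n-k) e
    -- of F_{n-k}, so u = z^(n-k) (e + u').
    obtain ⟨q, hq⟩ := hz.exists_eq_of_tmul_gen_eq_zero hk C (hC.trans hBV) _ hC0
    obtain ⟨D, hD, u', hxD, hu'⟩ := exists_local_preimage (toFiltrationQuotient hn hk F) q hxC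
    have hDV : D ≤ V := hD.trans (hC.trans hBV)
    have hmem : (toFiltrationQuotient hn hk F).app D (secRes (hD.trans hC) u -
        ringRes hDV z ^ (n - k) • u') = 0 := by
      have := congrArg (secRes hD) hq
      rw [secRes_secRes, secRes_smul, map_pow, ringRes_ringRes] at this
      rw [map_sub, app_secRes, this, Scheme.Modules.Hom.app_smul, hu', sub_self]
    rw [toFiltrationQuotient_app_eq_zero_iff] at hmem
    obtain ⟨G, hG, e, hxG, he⟩ := (hz.mem_firstFiltration_iff hDV _ _).mp hmem x hxD
    obtain ⟨H, hH, p, hxH, hp⟩ := exists_local_preimage φ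
      (e + secRes hG ((secondFiltration F k).ι.app D u')) hxG
    have hHV : H ≤ V := hH.trans (hG.trans hDV)
    have hHB : H ≤ B := hH.trans (hG.trans (hD.trans hC))
    have hker : φ.app H (secRes hHB v - ringRes hHV z ^ (n - k) • p) = 0 := by
      rw [map_sub, map_sub, sub_eq_iff_eq_add, app_secRes, secRes_secRes,
        Scheme.Modules.Hom.app_smul, secRes_smul, map_pow, ringRes_ringRes, ← smul_add] at he
      have := congrArg (secRes hH) he
      rw [secRes_smul, map_pow, ringRes_ringRes, ← hp, secRes_secRes] at this
      rw [map_sub, app_secRes, h₁, this, Scheme.Modules.Hom.app_smul, sub_self]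
    obtain ⟨l', hl'⟩ := exists_kernel_ι_app_eq φ H _ hker
    -- Subtracting z^(n-k) p from `v` does not change z^k v, because z^n = 0, and it moves `v` into
    -- the kernel.
    have hlast : secRes (hHB.trans hB) l = ringRes hHV z ^ k • l' := by
      refine app_injective_of_mono (kernel.ι φ) H ?_
      have := congrArg (secRes hHB) h₂
      rw [← app_secRes, secRes_secRes, secRes_smul, map_pow, ringRes_ringRes] at this
      rw [this, Scheme.Modules.Hom.app_smul, hl', smul_sub, smul_smul, ← pow_add,
        Nat.add_sub_cancel' hk, hz.ringRes_pow_eq_zero, zero_smul, sub_zero]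
    refine ⟨H, (hHB.trans hB).trans hA, hxH, ?_⟩
    rw [← secRes_secRes hA (hHB.trans hB), ← hl, ← app_secRes, toRestrict_app_eq_zero_iff,
      hz.mem_firstFiltration_iff hHV]
    exact fun y hy ↦ ⟨H, le_rfl, l', hy, by rw [secRes_self, hlast]⟩
  have hepi : Epi θ := by
    refine epi_of_local_preimage _ fun U t x hx ↦ ?_
    obtain ⟨A, hA, y, hxA, hy⟩ := exists_local_toTensor_eq t hx
    suffices H : ∀ y : Γ(filtrationQuotient hn hk F, A) ⊗[Γ(Y, A)] Γ(idealPow Y k, A),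
        ∃ (B : Y.Opens) (hB : B ≤ A) (m : Γ(restrictTo (kernel φ) k, B)), x ∈ B ∧
          θ.app B m = secRes hB (toTensor _ _ A y) by
      obtain ⟨B, hB, m, hxB, hm⟩ := H y
      exact ⟨B, hB.trans hA, m, hxB, by rw [hm, hy, secRes_secRes]⟩
    intro y
    induction y using TensorProduct.induction_on with
    | zero => exact ⟨A, le_rfl, 0, hxA, by rw [map_zero, map_zero, map_zero]⟩
    | add y y' h h' =>
      obtain ⟨B, hB, m, hxB, hm⟩ := h
      obtain ⟨B', hB', m', hxB', hm'⟩ := h'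
      refine ⟨B ⊓ B', inf_le_left.trans hB, secRes inf_le_left m + secRes inf_le_right m',
        ⟨hxB, hxB'⟩, ?_⟩
      rw [map_add, map_add, map_add, app_secRes, app_secRes, hm, hm', secRes_secRes, secRes_secRes]
    | tmul q s =>
      obtain ⟨B, hB, u, hxB, hu⟩ := exists_local_preimage (toFiltrationQuotient hn hk F) q hxA
      obtain ⟨C, hC, v, hxC, hv⟩ := exists_local_preimage φ
        ((secondFiltration F k).ι.app B u) hxB
      rw [← app_secRes] at hv
      obtain ⟨l, hl⟩ := idealPow.exists_smul_eq (secRes (hC.trans hB) s) v φ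
        (by rw [hv]; exact Subsheaf.ι_app_mem _ _)
      refine ⟨C, hC.trans hB, (toRestrict (kernel φ) k).app C l, hxC, ?_⟩
      rw [hθ', key _ _ _ _ hv hl, app_secRes, hu, ← tmul_eq, secRes_tmul, secRes_secRes]
  have : IsIso θ := isIso_of_mono_of_epi θ
  refine ⟨asIso θ, fun U u s v l h₁ h₂ ↦ (hθ' l).trans (key u s v l h₁ h₂), fun θ' hθ' ↦ ?_⟩
  apply Iso.ext
  change θ'.hom = θ
  rw [← cancel_epi (toRestrict (kernel φ) k), hθ]
  -- Uniqueness: every section of the kernel is locally of the form s v, where the required formula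
  -- dictates the value.
  refine hom_ext_apply fun U l ↦ eq_of_local _ _ _ fun x hx ↦ ?_
  obtain ⟨W, h, u, s, v, hxW, h₁, h₂, h₃⟩ := (hθ₀ U l _).mpr rfl x hx
  refine ⟨W, h, hxW, ?_⟩
  rw [h₃, ← app_secRes, comp_app_apply]
  exact hθ' W u s v _ h₁ h₂

end Comparison
end MultipleCurve

end

noncomputable section

open scoped TensorProduct

namespace MultipleCurve

universe u

/-! ### Smooth local algebras: a quotient of one dimension less is cut out by one equation. -/

section EssentiallySmooth

open KaehlerDifferential

/-- A local criterion for smoothness of relative dimension `p`: the `K`-algebra `A` is formally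
smooth and its module of differentials is free of rank `p`. -/
structure IsFormallySmoothOfRank (K A : Type*) [CommRing K] [CommRing A] [Algebra K A]
    (p : ℕ) : Prop where
  formallySmooth : Algebra.FormallySmooth K A
  free : Module.Free A Ω[A⁄K]
  finite : Module.Finite A Ω[A⁄K]
  finrank_eq : Module.finrank A Ω[A⁄K] = p

/-- The rank 0 case covers the residue field, so that one argument yields both the equation of the
curve and its uniformizer. -/
lemma IsFormallySmoothOfRank.of_bijective {K A : Type*} [CommRing K] [CommRing A] [Nontrivial A]
    [Algebra K A] (h : Function.Bijective (algebraMap K A)) : IsFormallySmoothOfRank K A 0 := by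
  have := KaehlerDifferential.subsingleton_of_surjective K A h.2
  exact ⟨.of_equiv (AlgEquiv.ofBijective (Algebra.ofId K A) h), inferInstance, inferInstance,
    Module.finrank_zero_of_subsingleton⟩

/-- The surjection splits, so the kernel is finite projective over a local ring, hence free, of rank
one by counting. -/
lemma exists_generator_ker {R M P : Type*} [CommRing R] [IsLocalRing R] [AddCommGroup M]
    [AddCommGroup P] [Module R M] [Module R P] [Module.Free R M] [Module.Finite R M]
    [Module.Free R P] [Module.Finite R P] (g : M →ₗ[R] P) (hg : Function.Surjective g)
    (h : Module.finrank R M = Module.finrank R P + 1) :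
    ∃ v, v ≠ 0 ∧ g v = 0 ∧ ∀ w, g w = 0 → ∃ c : R, c • v = w := by
  obtain ⟨r, hr⟩ := Module.projective_lifting_property g LinearMap.id hg
  let N := LinearMap.ker g
  let e : M ≃ₗ[R] N × P := ((LinearMap.exact_subtype_ker_map g).splitSurjectiveEquiv
    (LinearMap.ker g).injective_subtype ⟨r, hr⟩).1
  have hN : Module.Finite R N :=
    Module.Finite.of_surjective (LinearMap.fst R N P ∘ₗ e.toLinearMap)
      ((LinearMap.fst_surjective (R := R)).comp e.surjective)
  have hN' : Module.Projective R N :=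
    Module.Projective.of_split (e.symm.toLinearMap ∘ₗ LinearMap.inl R N P)
      (LinearMap.fst R N P ∘ₗ e.toLinearMap) (by ext x; simp)
  have hN'' : Module.Free R N := Module.free_of_flat_of_isLocalRing
  have hrank : Module.finrank R N = 1 := by
    have := e.finrank_eq
    rw [Module.finrank_prod] at this
    omega
  obtain ⟨v, hv0, hv⟩ := finrank_eq_one_iff'.mp hrank
  refine ⟨v.1, fun h0 ↦ hv0 (Subtype.ext h0), v.2, fun w hw ↦ ?_⟩
  obtain ⟨c, hc⟩ := hv ⟨w, hw⟩
  exact ⟨c, congr_arg Subtype.val hc⟩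

variable {K A D : Type*} [CommRing K] [CommRing A] [CommRing D] [Algebra K A] [Algebra K D]
  [Algebra A D] [IsScalarTower K A D]

/-- Let I be the kernel. Formal smoothness of `D` makes I/I² → D ⊗ Ω_A injective, with image the
rank one kernel of D ⊗ Ω_A → Ω_D. A lift f of a generator satisfies I = (f) + I², and Nakayama's
lemma gives I = (f). -/
lemma IsFormallySmoothOfRank.exists_ker_eq_span_singleton [IsLocalRing A] [IsNoetherianRing A]
    [IsLocalRing D] {p : ℕ} (h : Function.Surjective (algebraMap A D))
    (hA : IsFormallySmoothOfRank K A (p + 1)) (hD : IsFormallySmoothOfRank K D p) :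
    ∃ f : A, f ≠ 0 ∧ RingHom.ker (algebraMap A D) = Ideal.span {f} := by
  obtain ⟨_, _, _, hA⟩ := hA
  obtain ⟨_, _, _, hD⟩ := hD
  obtain ⟨l, hl⟩ := (Algebra.FormallySmooth.iff_split_injection (R := K) h).mp inferInstance
  have hinj : Function.Injective (kerCotangentToTensor K A D) :=
    Function.LeftInverse.injective (g := l) fun x ↦ LinearMap.congr_fun hl x
  obtain ⟨v, hv0, hvN, hv⟩ := exists_generator_ker (mapBaseChange K A D)
    (mapBaseChange_surjective K A D h) (by rw [Module.finrank_baseChange, hA, hD])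
  have hrange := range_kerCotangentToTensor K A D h
  have hvr : v ∈ LinearMap.range (kerCotangentToTensor K A D) := by
    rw [hrange]; exact hvN
  obtain ⟨i', hi'⟩ := hvr
  obtain ⟨i, rfl⟩ := Ideal.toCotangent_surjective _ i'
  refine ⟨i.1, fun h0 ↦ hv0 ?_, le_antisymm ?_ ?_⟩
  · rw [← hi', show i = 0 from Subtype.ext h0, map_zero, map_zero]
  · refine Submodule.le_of_le_smul_of_le_jacobson_bot (I := RingHom.ker (algebraMap A D))
      (IsNoetherian.noetherian _) ?_ ?_
    · rw [IsLocalRing.jacobson_eq_maximalIdeal _ bot_ne_top]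
      exact IsLocalRing.le_maximalIdeal (RingHom.ker_ne_top _)
    · intro w hw
      have hwN : mapBaseChange K A D
          (kerCotangentToTensor K A D (Ideal.toCotangent _ ⟨w, hw⟩)) = 0 := by
        have : kerCotangentToTensor K A D (Ideal.toCotangent _ ⟨w, hw⟩) ∈
          LinearMap.range (kerCotangentToTensor K A D) := ⟨_, rfl⟩
        rw [hrange] at this
        exact this
      obtain ⟨c, hc⟩ := hv _ hwN
      obtain ⟨a, rfl⟩ := h c
      have hmem : (⟨w, hw⟩ - a • i : RingHom.ker (algebraMap A D)).1 ∈
          RingHom.ker (algebraMap A D) ^ 2 := by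
        rw [← Ideal.toCotangent_eq_zero]
        apply hinj
        rw [map_zero, map_sub, map_sub, map_smul, map_smul, hi', sub_eq_zero, ← hc]
        exact algebraMap_smul D a v
      rw [pow_two] at hmem
      refine Submodule.mem_sup.mpr
        ⟨a * i.1, Ideal.mul_mem_left _ _ (Ideal.mem_span_singleton_self _), _, hmem, ?_⟩
      simp
  · exact (Ideal.span_singleton_le_iff_mem _).mpr i.2

end EssentiallySmooth

end MultipleCurve

end

noncomputable section

namespace MultipleCurve

/-! ### Generators of the nilradical: annihilators of powers and localization. -/

section NilpotentParameter

variable {R : Type*} [CommRing R]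

/-- Write τ = αz + βt. As z^(m+1) = 0, τ^j z^m = β^j z^m t^j, so regularity of τ gives z^m t^j ≠ 0
for all j. If z^m a = 0, then a ∈ (z, t^j) for every j: in a = zb + t^j c the coefficient c cannot
be a unit, hence c ∈ (z, t). Krull's theorem in R/(z) concludes. -/
lemma dvd_of_pow_mul_eq_zero [IsLocalRing R] [IsNoetherianRing R] {z t τ : R} {m : ℕ}
    (hm : IsLocalRing.maximalIdeal R = Ideal.span {z, t}) (hτ : τ ∈ IsLocalRing.maximalIdeal R)
    (hreg : ∀ a, τ * a = 0 → a = 0) (h1 : z ^ (m + 1) = 0) (h0 : z ^ m ≠ 0) {a : R}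
    (ha : z ^ m * a = 0) : z ∣ a := by
  have hzt (j : ℕ) : z ^ m * t ^ j ≠ 0 := by
    intro h
    rw [hm, Ideal.mem_span_pair] at hτ
    obtain ⟨α, β, rfl⟩ := hτ
    have key (i : ℕ) : (α * z + β * t) ^ i * z ^ m = β ^ i * (z ^ m * t ^ i) := by
      induction i with
      | zero => ring
      | succ i ih =>
        calc _ = (α * z + β * t) * ((α * z + β * t) ^ i * z ^ m) := by ring
          _ = β ^ (i + 1) * (z ^ m * t ^ (i + 1)) + α * β ^ i * t ^ i * z ^ (m + 1) := by
            rw [ih]; ring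
          _ = _ := by rw [h1]; ring
    have hpow (i : ℕ) (x : R) (hx : (α * z + β * t) ^ i * x = 0) : x = 0 := by
      induction i with
      | zero => simpa using hx
      | succ i ih => exact ih (hreg _ (by rw [← hx]; ring))
    exact h0 (hpow j _ (by rw [key, h, mul_zero]))
  have hclaim (j : ℕ) : ∃ b c, a = z * b + t ^ j * c := by
    induction j with
    | zero => exact ⟨0, a, by ring⟩
    | succ j ih =>
      obtain ⟨b, c, rfl⟩ := ih
      by_cases hc : IsUnit c
      · refine absurd (hc.mul_left_eq_zero.mp ?_) (hzt j)
        calc _ = z ^ m * (z * b + t ^ j * c) - b * z ^ (m + 1) := by ring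
          _ = 0 := by rw [ha, h1]; ring
      · have hc : c ∈ IsLocalRing.maximalIdeal R := hc
        rw [hm, Ideal.mem_span_pair] at hc
        obtain ⟨x, y, rfl⟩ := hc
        exact ⟨b + t ^ j * x, y, by ring⟩
  have hK := Ideal.iInf_pow_smul_eq_bot_of_isLocalRing (M := R ⧸ Ideal.span {z})
    (IsLocalRing.maximalIdeal R) (Ideal.IsPrime.ne_top inferInstance)
  rw [← Ideal.mem_span_singleton, ← Ideal.Quotient.eq_zero_iff_mem, ← Submodule.mem_bot R, ← hK,
    Submodule.mem_iInf]
  intro j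
  obtain ⟨b, c, rfl⟩ := hclaim j
  have : Ideal.Quotient.mk (Ideal.span {z}) (z * b + t ^ j * c) =
      t ^ j • Ideal.Quotient.mk (Ideal.span {z}) c := by
    rw [map_add, Ideal.Quotient.eq_zero_iff_mem.mpr
      (Ideal.mul_mem_right _ _ (Ideal.mem_span_singleton_self z)), zero_add, map_mul]
    rfl
  rw [this]
  refine Submodule.smul_mem_smul (Ideal.pow_mem_pow ?_ j) trivial
  rw [hm]
  exact Ideal.subset_span (by simp)

/-- The element `z` generates the nilradical of `R`, and its powers behave like those of the class
of `X` in `S[X] / (X ^ (m + 1))`. -/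
structure IsNilpotentParameter (m : ℕ) (z : R) : Prop where
  nilradical_eq : nilradical R = Ideal.span {z}
  pow_succ_eq_zero : z ^ (m + 1) = 0
  dvd_of_pow_mul_eq_zero {a : R} : z ^ m * a = 0 → z ∣ a

namespace IsNilpotentParameter

variable {m : ℕ} {z : R}

lemma pow_ne_zero [Nontrivial R] (h : IsNilpotentParameter m z) : z ^ m ≠ 0 := fun h0 ↦ by
  have h1 : IsUnit z := isUnit_of_dvd_one (h.dvd_of_pow_mul_eq_zero (by rw [h0, zero_mul]))
  exact not_isUnit_zero (h.pow_succ_eq_zero ▸ h1.pow (m + 1))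

lemma nilradical_pow_eq_bot_iff [Nontrivial R] (h : IsNilpotentParameter m z) {i : ℕ} :
    nilradical R ^ i = ⊥ ↔ m < i := by
  rw [h.nilradical_eq, Ideal.span_singleton_pow, Ideal.span_singleton_eq_bot]
  refine ⟨fun h0 ↦ not_le.mp fun hi ↦ h.pow_ne_zero ?_, fun hi ↦ ?_⟩
  · rw [← Nat.sub_add_cancel hi, pow_add, h0, mul_zero]
  · rw [← Nat.sub_add_cancel (Nat.succ_le_of_lt hi), pow_add, h.pow_succ_eq_zero, mul_zero]

/-- The exponent is intrinsic, being read off from the vanishing powers of the nilradical; this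
makes it locally constant on Y. -/
lemma eq_of_nontrivial [Nontrivial R] (h : IsNilpotentParameter m z) {m' : ℕ} {z' : R}
    (h' : IsNilpotentParameter m' z') : m = m' :=
  le_antisymm
    (Nat.lt_succ_iff.mp (h.nilradical_pow_eq_bot_iff.mp
      (h'.nilradical_pow_eq_bot_iff.mpr m'.lt_succ_self)))
    (Nat.lt_succ_iff.mp (h'.nilradical_pow_eq_bot_iff.mp
      (h.nilradical_pow_eq_bot_iff.mpr m.lt_succ_self)))

lemma pow_dvd_of_pow_mul_eq_zero (h : IsNilpotentParameter m z) {k : ℕ} (hk : k ≤ m + 1) {a : R}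
    (ha : z ^ k * a = 0) : z ^ (m + 1 - k) ∣ a := by
  have key (j : ℕ) (hj : j ≤ m + 1 - k) : z ^ j ∣ a := by
    induction j with
    | zero => simp
    | succ j ih =>
      obtain ⟨c, rfl⟩ := ih (by omega)
      rw [pow_succ]
      refine mul_dvd_mul_left _ (h.dvd_of_pow_mul_eq_zero ?_)
      rw [← mul_assoc, ← pow_add] at ha
      -- From z^(k+j) c = 0 one reaches z^m c = 0, the only exponent covered by the definition.
      rw [show m = (m - (k + j)) + (k + j) by omega, pow_add, mul_assoc, ha, mul_zero]
  exact key _ le_rfl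

lemma of_associated (h : IsNilpotentParameter m z) {w : R} (hw : Associated z w) :
    IsNilpotentParameter m w where
  nilradical_eq := h.nilradical_eq.trans <| le_antisymm
    (Ideal.span_singleton_le_span_singleton.mpr hw.symm.dvd)
    (Ideal.span_singleton_le_span_singleton.mpr hw.dvd)
  pow_succ_eq_zero := by
    obtain ⟨u, rfl⟩ := hw
    rw [mul_pow, h.pow_succ_eq_zero, zero_mul]
  dvd_of_pow_mul_eq_zero {a} ha := by
    refine hw.symm.dvd.trans (h.dvd_of_pow_mul_eq_zero ?_)
    obtain ⟨u, hu⟩ := hw.pow_pow (n := m)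
    rw [← hu, mul_right_comm] at ha
    exact u.isUnit.mul_left_eq_zero.mp ha

end IsNilpotentParameter

/-- Finitely many generators need only one common denominator. -/
lemma exists_forall_mul_mem_of_map_le (p : Ideal R) [p.IsPrime] (S : Type*) [CommRing S]
    [Algebra R S] [IsLocalization.AtPrime S p] {I J : Ideal R} (hI : I.FG)
    (h : ∀ g ∈ I, algebraMap R S g ∈ J.map (algebraMap R S)) :
    ∃ s ∉ p, ∀ g ∈ I, s * g ∈ J := by
  classical
  obtain ⟨T, rfl⟩ := hI
  have (g : R) (hg : g ∈ T) : ∃ s ∉ p, s * g ∈ J := by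
    obtain ⟨⟨a, s⟩, has⟩ := (IsLocalization.mem_map_algebraMap_iff p.primeCompl S).mp
      (h g (Ideal.subset_span hg))
    rw [← map_mul] at has
    obtain ⟨c, hc⟩ := (IsLocalization.eq_iff_exists p.primeCompl S).mp has
    refine ⟨c.1 * s.1, (p.primeCompl.mul_mem c.2 s.2), ?_⟩
    rw [mul_assoc, mul_comm s.1, hc]
    exact J.mul_mem_left _ a.2
  choose! s hsp hs using this
  refine ⟨∏ g ∈ T, s g, ?_, fun g hg ↦ ?_⟩
  · exact prod_mem (S := p.primeCompl) fun g hg ↦ hsp g hg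
  · induction hg using Submodule.span_induction with
    | mem g hg =>
      rw [← Finset.mul_prod_erase T s hg, mul_right_comm]
      exact J.mul_mem_right _ (hs g hg)
    | zero => simp
    | add x y _ _ hx hy => rw [mul_add]; exact add_mem hx hy
    | smul c x _ hx => rw [smul_eq_mul, mul_left_comm]; exact J.mul_mem_left _ hx

/-- Each of the three defining conditions is an inclusion between finitely generated ideals, so all
of them persist wherever a single element s is invertible. -/
lemma IsNilpotentParameter.exists_forall_localization [IsNoetherianRing R] (p : Ideal R)
    [p.IsPrime] {S : Type*} [CommRing S] [Algebra R S] [IsLocalization.AtPrime S p] {m : ℕ} {z : S}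
    (h : IsNilpotentParameter m z) :
    ∃ ζ s : R, s ∉ p ∧ ∀ (q : Ideal R) [q.IsPrime] (S' : Type*) [CommRing S'] [Algebra R S']
      [IsLocalization.AtPrime S' q], s ∉ q → IsNilpotentParameter m (algebraMap R S' ζ) := by
  -- Clearing the denominator changes `z` only by a unit.
  obtain ⟨⟨ζ, t⟩, hζ⟩ := IsLocalization.surj p.primeCompl z
  replace h := h.of_associated (w := algebraMap R S ζ)
    ⟨(IsLocalization.map_units S t).unit, hζ⟩
  obtain ⟨s₁, hs₁, H₁⟩ := exists_forall_mul_mem_of_map_le p S (I := nilradical R)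
    (J := Ideal.span {ζ}) (IsNoetherian.noetherian _) fun g hg ↦ by
      rw [Ideal.map_span, Set.image_singleton, ← h.nilradical_eq]
      exact (mem_nilradical.mp hg).map _
  obtain ⟨s₂, hs₂, H₂⟩ := exists_forall_mul_mem_of_map_le p S (I := Ideal.span {ζ ^ (m + 1)})
    (J := ⊥) (IsNoetherian.noetherian _) fun g hg ↦ by
      obtain ⟨c, rfl⟩ := Ideal.mem_span_singleton.mp hg
      rw [map_mul, map_pow, h.pow_succ_eq_zero, zero_mul]
      exact zero_mem _
  obtain ⟨s₃, hs₃, H₃⟩ := exists_forall_mul_mem_of_map_le p S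
    (I := LinearMap.ker (LinearMap.mulLeft R (ζ ^ m))) (J := Ideal.span {ζ})
    (IsNoetherian.noetherian _) fun g hg ↦ by
      rw [Ideal.map_span, Set.image_singleton, Ideal.mem_span_singleton]
      refine h.dvd_of_pow_mul_eq_zero ?_
      rw [← map_pow, ← map_mul, show ζ ^ m * g = 0 from hg, map_zero]
  refine ⟨ζ, s₁ * s₂ * s₃, p.primeCompl.mul_mem (p.primeCompl.mul_mem hs₁ hs₂) hs₃,
    fun q _ S' _ _ _ hs ↦ ?_⟩
  have hu {s : R} (hs : s ∉ q) : IsUnit (algebraMap R S' s) :=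
    IsLocalization.map_units S' (⟨s, hs⟩ : q.primeCompl)
  have hq₁ : s₁ ∉ q := fun h ↦ hs (Ideal.mul_mem_right _ _ (Ideal.mul_mem_right _ _ h))
  have hq₂ : s₂ ∉ q := fun h ↦ hs (Ideal.mul_mem_right _ _ (Ideal.mul_mem_left _ _ h))
  have hq₃ : s₃ ∉ q := fun h ↦ hs (Ideal.mul_mem_left _ _ h)
  have hpow : algebraMap R S' ζ ^ (m + 1) = 0 := by
    have := H₂ _ (Ideal.mem_span_singleton_self _)
    rw [Ideal.mem_bot] at this
    rw [← (hu hq₂).mul_right_eq_zero, ← map_pow, ← map_mul, this, map_zero]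
  have hdvd {s : R} (hs : s ∉ q) {a : R} (ha : s * a ∈ Ideal.span {ζ}) :
      algebraMap R S' ζ ∣ algebraMap R S' a := by
    rw [← (hu hs).dvd_mul_left, ← map_mul]
    exact map_dvd _ (Ideal.mem_span_singleton.mp ha)
  refine ⟨le_antisymm (fun x hx ↦ ?_) ?_, hpow, fun {x} hx ↦ ?_⟩
  · obtain ⟨⟨a, t⟩, hat⟩ := IsLocalization.surj q.primeCompl x
    obtain ⟨N, hN⟩ := hx
    obtain ⟨c, hc⟩ := (IsLocalization.map_eq_zero_iff q.primeCompl S' (a ^ N)).mp (by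
      rw [map_pow, ← hat, mul_pow, hN, zero_mul])
    rw [Ideal.mem_span_singleton, ← (hu t.2).dvd_mul_right, hat, ← (hu c.2).dvd_mul_left,
      ← map_mul]
    -- The exponent `N + 1` leaves room for the factor c a^N = 0 even when `N = 0`.
    refine hdvd hq₁ (H₁ _ ⟨N + 1, ?_⟩)
    calc (c.1 * a) ^ (N + 1) = c ^ N * a * (c * a ^ N) := by ring
      _ = 0 := by rw [hc, mul_zero]
  · rw [Ideal.span_singleton_le_iff_mem]
    exact ⟨m + 1, hpow⟩
  · obtain ⟨⟨a, t⟩, hat⟩ := IsLocalization.surj q.primeCompl x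
    obtain ⟨c, hc⟩ := (IsLocalization.map_eq_zero_iff q.primeCompl S' (ζ ^ m * a)).mp (by
      rw [map_mul, map_pow, ← hat, ← mul_assoc, hx, zero_mul])
    rw [← (hu t.2).dvd_mul_right, hat, ← (hu c.2).dvd_mul_left, ← map_mul]
    refine hdvd hq₃ (H₃ _ ?_)
    change ζ ^ m * (c.1 * a) = 0
    rw [mul_left_comm, hc]

end NilpotentParameter

end MultipleCurve

end

noncomputable section

namespace MultipleCurve

/-! ### The local ring of Y between those of a smooth surface and of the curve. -/

section LocalStructure

open KaehlerDifferential

/-- If the regular sequence were empty, the dimension would be 0 and the nilradical would be the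
maximal ideal. -/
lemma IsCohenMacaulayLocalRing.exists_isSMulRegular {R : Type*} [CommRing R] [IsLocalRing R]
    (h : IsCohenMacaulayLocalRing R) (hR : nilradical R ≠ IsLocalRing.maximalIdeal R) :
    ∃ τ ∈ IsLocalRing.maximalIdeal R, IsSMulRegular R τ := by
  obtain ⟨_, rs, hrs, hreg, hdim⟩ := h
  cases rs with
  | nil =>
    have : Ring.KrullDimLE 0 R := Ring.krullDimLE_iff.mpr hdim.ge
    exact absurd (Ring.KrullDimLE.nilradical_eq_maximalIdeal R) hR
  | cons τ rs =>
    exact ⟨τ, hrs τ (by simp),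
      ((RingTheory.Sequence.isRegular_cons_iff R τ rs).mp hreg).1⟩

/-- The equation f of D in A maps to a generator z of the nilradical of R, and a lift t of a
uniformizer of D completes it to generators of the maximal ideal. -/
lemma exists_isNilpotentParameter {K A R D k : Type*} [CommRing K] [CommRing A] [CommRing R]
    [CommRing D] [Field k] [IsLocalRing A] [IsLocalRing R] [IsLocalRing D] [IsNoetherianRing A]
    [Algebra K A] [Algebra K D] [Algebra K k] [Algebra A R] [Algebra R D] [Algebra A D]
    [Algebra D k] [IsScalarTower K A D] [IsScalarTower K D k] [IsScalarTower A R D]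
    (hA : IsFormallySmoothOfRank K A 2) (hD : IsFormallySmoothOfRank K D 1)
    (hk : Function.Bijective (algebraMap K k)) (hAR : Function.Surjective (algebraMap A R))
    (hRD : Function.Surjective (algebraMap R D)) (hDk : Function.Surjective (algebraMap D k))
    (hker : RingHom.ker (algebraMap R D) = nilradical R) (hR : IsCohenMacaulayLocalRing R) :
    ∃ (m : ℕ) (z : R), IsNilpotentParameter m z := by
  have hAD : Function.Surjective (algebraMap A D) := by
    rw [IsScalarTower.algebraMap_eq A R D]
    exact hRD.comp hAR
  have : IsNoetherianRing D := isNoetherianRing_of_surjective A D _ hAD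
  have : IsNoetherianRing R := hR.1
  obtain ⟨f, -, hf⟩ := hA.exists_ker_eq_span_singleton hAD hD
  obtain ⟨t', ht0, ht'⟩ := hD.exists_ker_eq_span_singleton hDk (.of_bijective hk)
  have hmax : IsLocalRing.maximalIdeal D = Ideal.span {t'} := by
    rw [← ht']
    exact (IsLocalRing.eq_maximalIdeal (RingHom.ker_isMaximal_of_surjective _ hDk)).symm
  obtain ⟨t, rfl⟩ := hRD t'
  let z := algebraMap A R f
  have hz : nilradical R = Ideal.span {z} := by
    rw [← hker]
    refine le_antisymm (fun x hx ↦ ?_) ?_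
    · obtain ⟨a, rfl⟩ := hAR x
      have : a ∈ RingHom.ker (algebraMap A D) := by
        rw [RingHom.mem_ker, IsScalarTower.algebraMap_apply A R D]
        exact hx
      rw [hf, Ideal.mem_span_singleton] at this
      exact Ideal.mem_span_singleton.mpr (map_dvd _ this)
    · rw [Ideal.span_singleton_le_iff_mem, RingHom.mem_ker, ← IsScalarTower.algebraMap_apply,
        ← RingHom.mem_ker, hf]
      exact Ideal.mem_span_singleton_self f
  have hloc : IsLocalHom (algebraMap R D) := IsLocalHom.of_surjective _ hRD
  have ht : t ∈ IsLocalRing.maximalIdeal R := by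
    rw [IsLocalRing.mem_maximalIdeal, mem_nonunits_iff, ← isUnit_map_iff (algebraMap R D),
      ← mem_nonunits_iff, ← IsLocalRing.mem_maximalIdeal, hmax]
    exact Ideal.mem_span_singleton_self _
  have hzmem : z ∈ nilradical R := by
    rw [hz]
    exact Ideal.mem_span_singleton_self z
  have hm : IsLocalRing.maximalIdeal R = Ideal.span {z, t} := by
    refine le_antisymm (fun x hx ↦ ?_) ?_
    · have hx' : algebraMap R D x ∈ IsLocalRing.maximalIdeal D := by
        rwa [IsLocalRing.mem_maximalIdeal, mem_nonunits_iff, isUnit_map_iff]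
      rw [hmax, Ideal.mem_span_singleton] at hx'
      obtain ⟨y, hy⟩ := hx'
      obtain ⟨y, rfl⟩ := hRD y
      have : x - t * y ∈ nilradical R := by
        rw [← hker, RingHom.mem_ker, map_sub, hy, map_mul, sub_self]
      rw [hz, Ideal.mem_span_singleton] at this
      obtain ⟨c, hc⟩ := this
      exact Ideal.mem_span_pair.mpr ⟨c, y, by rw [mul_comm c, ← hc]; ring⟩
    · rw [Ideal.span_le]
      rintro x (rfl | rfl)
      · exact nilradical_le_prime _ hzmem
      · exact ht
  -- Were the nilradical maximal, t would vanish in D, whereas the uniformizer is nonzero.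
  obtain ⟨τ, hτ, hreg⟩ := hR.exists_isSMulRegular fun h ↦ ht0 (by
    rw [← h, ← hker] at ht
    exact ht)
  classical
  obtain ⟨N, hN, hmin⟩ : ∃ N, z ^ N = 0 ∧ ∀ i < N, z ^ i ≠ 0 :=
    ⟨Nat.find hzmem, Nat.find_spec hzmem, fun i hi ↦ Nat.find_min hzmem hi⟩
  cases N with
  | zero => exact absurd (hN.symm.trans (pow_zero z)) zero_ne_one
  | succ m =>
    refine ⟨m, z, hz, hN, fun {a} ha ↦ dvd_of_pow_mul_eq_zero hm hτ (fun a ha ↦ ?_) hN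
      (hmin m m.lt_succ_self) ha⟩
    exact hreg (by simpa using ha)

lemma IsFormallySmoothOfRank.of_isLocalization {K B S : Type*} [CommRing K] [CommRing B]
    [CommRing S] [Nontrivial S] [Algebra K B] [Algebra B S] [Algebra K S] [IsScalarTower K B S]
    (M : Submonoid B) [IsLocalization M S] {p : ℕ}
    (h : Algebra.IsStandardSmoothOfRelativeDimension p K B) : IsFormallySmoothOfRank K S p := by
  have : Nontrivial B := (algebraMap B S).domain_nontrivial
  have := h.isStandardSmooth
  have : Algebra.FormallyEtale B S := .of_isLocalization M
  let e := tensorKaehlerEquivOfFormallyEtale K B S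
  have hr := Algebra.IsStandardSmoothOfRelativeDimension.rank_kaehlerDifferential (R := K) (S := B) p
  refine ⟨.comp K B S, .of_equiv e, .equiv e, ?_⟩
  rw [← e.finrank_eq, Module.finrank_baseChange]
  exact Module.finrank_eq_of_rank_eq hr

end LocalStructure

/-! ### Stalks of smooth schemes over ℂ. -/

section Stalks

/-- The structure of `ℂ`-algebra on the stalks of a scheme over `ℂ`. -/
def stalkBase {X : Scheme.{0}} (f : X ⟶ Spec (.of ℂ)) (x : X) : ℂ →+* X.presheaf.stalk x :=
  ((Scheme.ΓSpecIso (.of ℂ)).inv ≫ f.appTop ≫ X.presheaf.germ ⊤ x trivial).hom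

lemma stalkBase_comp {X Y : Scheme.{0}} (h : X ⟶ Y) (g : Y ⟶ Spec (.of ℂ)) (x : X) :
    stalkBase (h ≫ g) x = (h.stalkMap x).hom.comp (stalkBase g (h x)) := by
  rw [stalkBase, stalkBase, ← CommRingCat.hom_comp]
  congr 1
  rw [Category.assoc, Category.assoc, Scheme.Hom.comp_appTop, Category.assoc]
  congr 2
  exact (Scheme.Hom.germ_stalkMap h ⊤ x trivial).symm

lemma isFormallySmoothOfRank_stalk {X : Scheme.{0}} (f : X ⟶ Spec (.of ℂ)) (p : ℕ)
    [SmoothOfRelativeDimension p f] (x : X) :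
    letI := (stalkBase f x).toAlgebra
    IsFormallySmoothOfRank ℂ (X.presheaf.stalk x) p := by
  obtain ⟨U, hU, V, hV, hx, e, hf⟩ :=
    SmoothOfRelativeDimension.exists_isStandardSmoothOfRelativeDimension (n := p) (f := f) x
  -- Spec ℂ has a single point.
  obtain rfl : U = ⊤ := top_le_iff.mp fun y _ ↦ by
    rw [Subsingleton.elim y (f x)]
    exact e hx
  let r : ℂ →+* Γ(X, V) := ((Scheme.ΓSpecIso (.of ℂ)).inv ≫ f.appLE ⊤ V e).hom
  have hr : RingHom.IsStandardSmoothOfRelativeDimension p r :=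
    RingHom.isStandardSmoothOfRelativeDimension_respectsIso.2 _
      (Scheme.ΓSpecIso (.of ℂ)).symm.commRingCatIsoToRingEquiv hf
  let := r.toAlgebra
  let := (stalkBase f x).toAlgebra
  let := X.presheaf.algebra_section_stalk ⟨x, hx⟩
  have : IsScalarTower ℂ Γ(X, V) (X.presheaf.stalk x) := .of_algebraMap_eq' (by
    change stalkBase f x = (((Scheme.ΓSpecIso (.of ℂ)).inv ≫ f.appLE ⊤ V e) ≫
      X.presheaf.germ V x hx).hom
    rw [stalkBase, Category.assoc, Scheme.Hom.appLE, Category.assoc, X.presheaf.germ_res]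
    rfl)
  have := hV.isLocalization_stalk ⟨x, hx⟩
  exact .of_isLocalization (hV.primeIdealOf ⟨x, hx⟩).asIdeal.primeCompl hr

end Stalks

end MultipleCurve

end

noncomputable section

namespace MultipleCurve

universe u

/-! ### Stalks of the reduced subscheme. -/

section Reduction

variable {Y : Scheme.{u}}

lemma mem_nilradical_ideal_iff {V : Y.affineOpens} {a : Γ(Y, V.1)} :
    a ∈ Y.nilradical.ideal V ↔ IsNilpotent a := Iff.rfl

lemma exists_affine_germ_eq (x : Y) (r : Y.presheaf.stalk x) :
    ∃ (V : Y.affineOpens) (hx : x ∈ V.1) (g : Γ(Y, V.1)), Y.presheaf.germ V.1 x hx g = r := by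
  obtain ⟨U, hU, g, rfl⟩ := Y.presheaf.exists_germ_eq r
  obtain ⟨V, hV, hVU⟩ := exists_affine Y hU
  exact ⟨V, hV, ringRes hVU g, Y.presheaf.germ_res_apply (homOfLE hVU) x hV g⟩

lemma germ_ringRes {U V : Y.Opens} (h : V ≤ U) {x : Y} (hx : x ∈ V) (g : Γ(Y, U)) :
    Y.presheaf.germ V x hx (ringRes h g) = Y.presheaf.germ U x (h hx) g :=
  Y.presheaf.germ_res_apply (homOfLE h) x hx g

lemma exists_affine_ringRes_eq_zero {x : Y} {V : Y.Opens} (hx : x ∈ V) {g : Γ(Y, V)}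
    (h : Y.presheaf.germ V x hx g = 0) :
    ∃ (W : Y.affineOpens) (hW : W.1 ≤ V), x ∈ W.1 ∧ ringRes hW g = 0 := by
  obtain ⟨U, hU, i, j, e⟩ := Y.presheaf.germ_eq x hx hx g 0 (h.trans (map_zero _).symm)
  obtain ⟨W, hW, hWU⟩ := exists_affine Y hU
  refine ⟨W, hWU.trans (leOfHom i), hW, ?_⟩
  have e' : ringRes (leOfHom i) g = 0 := e.trans (map_zero _)
  rw [← ringRes_ringRes (leOfHom i) hWU, e', map_zero]

lemma ker_stalkMap_subschemeι_nilradical (c : Y.nilradical.subscheme) :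
    RingHom.ker (Y.nilradical.subschemeι.stalkMap c).hom =
      nilradical (Y.presheaf.stalk (Y.nilradical.subschemeι c)) := by
  ext r
  rw [RingHom.mem_ker, mem_nilradical]
  obtain ⟨V, hx, g, rfl⟩ := exists_affine_germ_eq _ r
  have key (W : Y.affineOpens) (hW : W.1 ≤ V.1) (hxW : Y.nilradical.subschemeι c ∈ W.1) :
      Y.nilradical.subschemeι.stalkMap c (Y.presheaf.germ V.1 _ hx g) =
        Y.nilradical.subscheme.presheaf.germ (Y.nilradical.subschemeι ⁻¹ᵁ W.1) c hxW
          (Y.nilradical.subschemeι.app W.1 (ringRes hW g)) := by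
    rw [← germ_ringRes hW hxW]
    exact Scheme.Hom.germ_stalkMap_apply _ _ _ _ _
  have happ (W : Y.affineOpens) (a : Γ(Y, W.1)) :
      Y.nilradical.subschemeι.app W.1 a = 0 ↔ IsNilpotent a := by
    rw [← mem_nilradical_ideal_iff, ← Scheme.IdealSheafData.ker_subschemeι_app]
    rfl
  constructor
  · intro h
    have h := (key V le_rfl hx).symm.trans h
    rw [ringRes_self] at h
    obtain ⟨W, hW, hcW, hz⟩ := exists_affine_ringRes_eq_zero _ h
    -- Vanishing near `c` on the reduced subscheme is transported to Y, because its open sets are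
    -- traces of open sets of Y.
    obtain ⟨W', hW', hWW'⟩ := Y.nilradical.subschemeι.isEmbedding.isInducing.isOpen_iff.mp W.1.2
    obtain ⟨V', hxV', hV'⟩ := exists_affine Y (U := ⟨W', hW'⟩ ⊓ V.1) (x := Y.nilradical.subschemeι c)
      ⟨show c ∈ Y.nilradical.subschemeι ⁻¹' W' by rw [hWW']; exact hcW, hx⟩
    have hle : Y.nilradical.subschemeι ⁻¹ᵁ V'.1 ≤ W.1 := fun y hy ↦ by
      have : y ∈ Y.nilradical.subschemeι ⁻¹' W' := (hV' hy).1
      rwa [hWW'] at this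
    have hnil : IsNilpotent (ringRes (hV'.trans inf_le_right) g) := by
      rw [← happ]
      have e : Y.nilradical.subschemeι.app V'.1 (ringRes (hV'.trans inf_le_right) g) =
          ringRes hle (ringRes hW (Y.nilradical.subschemeι.app V.1 g)) := by
        rw [ringRes_ringRes]
        exact ConcreteCategory.congr_hom (Y.nilradical.subschemeι.naturality
          (homOfLE (hV'.trans inf_le_right)).op) g
      rw [e, hz, map_zero]
    rw [← germ_ringRes (hV'.trans inf_le_right) hxV']
    exact hnil.map _
  · rintro ⟨N, hN⟩
    rw [← map_pow] at hN
    obtain ⟨W, hW, hxW, hz⟩ := exists_affine_ringRes_eq_zero _ hN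
    rw [key W hW hxW, (happ W _).mpr ⟨N, by rw [← map_pow, hz]⟩, map_zero]

end Reduction

/-! ### Residue fields at closed points are ℂ. -/

section ResidueField

lemma SpecMap_stalkBase {X : Scheme.{0}} (f : X ⟶ Spec (.of ℂ)) (x : X) :
    Spec.map (CommRingCat.ofHom (stalkBase f x)) = X.fromSpecStalk x ≫ f := by
  rw [stalkBase, CommRingCat.ofHom_hom, Spec.map_comp, Spec.map_comp,
    ← Scheme.fromSpecStalk_toSpecΓ, Category.assoc, Category.assoc,
    ← Scheme.toSpecΓ_naturality_assoc, toSpecΓ_SpecMap_ΓSpecIso_inv, Category.comp_id]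

lemma bijective_residue_comp_stalkBase {X : Scheme.{0}} (f : X ⟶ Spec (.of ℂ))
    [LocallyOfFiniteType f] (x : X) (hx : IsClosed {x}) :
    Function.Bijective ((X.residue x).hom.comp (stalkBase f x)) := by
  have : (residueFieldIsoBase f x hx).inv = CommRingCat.ofHom (stalkBase f x) ≫ X.residue x := by
    apply Spec.map_injective
    rw [SpecMap_residueFieldIsoBase_inv, Spec.map_comp, SpecMap_stalkBase,
      Scheme.fromSpecResidueField, Category.assoc]
  change Function.Bijective (CommRingCat.ofHom (stalkBase f x) ≫ X.residue x).hom
  rw [← this]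
  exact (residueFieldIsoBase f x hx).symm.commRingCatIsoToRingEquiv.bijective

end ResidueField

end MultipleCurve

end

noncomputable section

namespace MultipleCurve

/-! ### Local parameters on a primitive multiple curve. -/

section PrimitiveCurve

variable {Y : Scheme.{0}} {π : Y ⟶ Spec (.of ℂ)} {n : ℕ}

lemma IsPrimitiveMultipleCurve.exists_isNilpotentParameter (hY : IsPrimitiveMultipleCurve π n)
    (x : Y) (hx : IsClosed {x}) :
    ∃ (m : ℕ) (z : Y.presheaf.stalk x), IsNilpotentParameter m z := by
  obtain ⟨S, σ, U, j, hxU, _, _, hj⟩ := hY.primitive x hx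
  have := hY.locallyOfFiniteType
  have := hY.support.smooth
  have : LocallyOfFiniteType σ :=
    have := SmoothOfRelativeDimension.smooth 2 σ
    inferInstance
  have : IsLocallyNoetherian S := LocallyOfFiniteType.isLocallyNoetherian σ
  obtain ⟨c, rfl⟩ : ∃ c, Y.nilradical.subschemeι c = x := by
    have : x ∈ Set.range Y.nilradical.subschemeι := by
      rw [Scheme.IdealSheafData.range_subschemeι, Scheme.support_nilradical]
      trivial
    exact this
  let i := Y.nilradical.subschemeι
  have hc : IsClosed {c} := by
    have : {c} = i ⁻¹' {i c} := by
      ext y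
      exact ⟨fun h ↦ congr_arg i h, fun h ↦ i.isEmbedding.injective h⟩
    rw [this]
    exact hx.preimage i.continuous
  let u : (U : Scheme.{0}) := ⟨i c, hxU⟩
  let e : Y.presheaf.stalk (i c) ⟶ (U : Scheme.{0}).presheaf.stalk u := U.ι.stalkMap u
  have : IsIso e := inferInstanceAs (IsIso (U.ι.stalkMap u))
  -- An immersion is surjective on stalks, and the stalks of Y and of its open subscheme agree; so
  -- the local ring of Y is a quotient of that of the surface.
  let ρ : S.presheaf.stalk (j u) ⟶ Y.presheaf.stalk (i c) := j.stalkMap u ≫ inv e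
  have hρ : Function.Surjective ρ := by
    rw [CategoryTheory.hom_comp]
    exact (ConcreteCategory.bijective_of_isIso (inv e)).2.comp (j.stalkMap_surjective u)
  have hρσ : ρ.hom.comp (stalkBase σ (j u)) = stalkBase π (i c) := by
    have h := stalkBase_comp j σ u
    rw [hj, stalkBase_comp] at h
    have h' : CommRingCat.ofHom (stalkBase π (i c)) ≫ e =
        CommRingCat.ofHom (stalkBase σ (j u)) ≫ j.stalkMap u := by
      ext1
      exact h
    have : CommRingCat.ofHom (stalkBase π (i c)) = CommRingCat.ofHom (stalkBase σ (j u)) ≫ ρ := by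
      rw [← cancel_mono e, h', Category.assoc, Category.assoc, IsIso.inv_hom_id, Category.comp_id]
    exact (congr_arg CommRingCat.Hom.hom this).symm
  let _ : Algebra ℂ (S.presheaf.stalk (j u)) := (stalkBase σ (j u)).toAlgebra
  let _ : Algebra ℂ (Y.nilradical.subscheme.presheaf.stalk c) := (stalkBase (i ≫ π) c).toAlgebra
  let _ : Algebra ℂ (Y.nilradical.subscheme.residueField c) :=
    ((Y.nilradical.subscheme.residue c).hom.comp (stalkBase (i ≫ π) c)).toAlgebra
  let _ : Algebra (Y.nilradical.subscheme.presheaf.stalk c)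
      (Y.nilradical.subscheme.residueField c) := (Y.nilradical.subscheme.residue c).hom.toAlgebra
  let _ : Algebra (S.presheaf.stalk (j u)) (Y.presheaf.stalk (i c)) := ρ.hom.toAlgebra
  let _ : Algebra (Y.presheaf.stalk (i c)) (Y.nilradical.subscheme.presheaf.stalk c) :=
    (i.stalkMap c).hom.toAlgebra
  let _ : Algebra (S.presheaf.stalk (j u)) (Y.nilradical.subscheme.presheaf.stalk c) :=
    ((i.stalkMap c).hom.comp ρ.hom).toAlgebra
  have : IsScalarTower (S.presheaf.stalk (j u)) (Y.presheaf.stalk (i c))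
      (Y.nilradical.subscheme.presheaf.stalk c) := .of_algebraMap_eq' rfl
  have : IsScalarTower ℂ (Y.nilradical.subscheme.presheaf.stalk c)
      (Y.nilradical.subscheme.residueField c) := .of_algebraMap_eq' rfl
  have : IsScalarTower ℂ (S.presheaf.stalk (j u)) (Y.nilradical.subscheme.presheaf.stalk c) :=
    .of_algebraMap_eq' (by
      change stalkBase (i ≫ π) c = ((i.stalkMap c).hom.comp ρ.hom).comp (stalkBase σ (j u))
      rw [RingHom.comp_assoc, hρσ, stalkBase_comp])
  exact MultipleCurve.exists_isNilpotentParameter (K := ℂ) (A := S.presheaf.stalk (j u))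
    (R := Y.presheaf.stalk (i c)) (D := Y.nilradical.subscheme.presheaf.stalk c)
    (k := Y.nilradical.subscheme.residueField c)
    (isFormallySmoothOfRank_stalk σ 2 (j u)) (isFormallySmoothOfRank_stalk (i ≫ π) 1 c)
    (bijective_residue_comp_stalkBase (i ≫ π) c hc) hρ (i.stalkMap_surjective c)
    (Y.nilradical.subscheme.residue_surjective c) (ker_stalkMap_subschemeι_nilradical c)
    (hY.cohenMacaulay _)

lemma exists_open_isNilpotentParameter {Y : Scheme.{0}} [IsLocallyNoetherian Y] {x : Y} {m : ℕ}
    {z : Y.presheaf.stalk x} (hz : IsNilpotentParameter m z) :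
    ∃ (V : Y.Opens) (ζ : Γ(Y, V)), x ∈ V ∧
      ∀ (y : Y) (hy : y ∈ V), IsNilpotentParameter m (Y.presheaf.germ V y hy ζ) := by
  obtain ⟨V, hxV, -⟩ := exists_affine Y (U := ⊤) (x := x) trivial
  have := IsLocallyNoetherian.component_noetherian V
  let _ := Y.presheaf.algebra_section_stalk ⟨x, hxV⟩
  have := V.2.isLocalization_stalk ⟨x, hxV⟩
  obtain ⟨ζ, s, hs, H⟩ := hz.exists_forall_localization (V.2.primeIdealOf ⟨x, hxV⟩).asIdeal
  have hmem (y : Y) (hy : y ∈ V.1) :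
      y ∈ Y.basicOpen s ↔ s ∉ (V.2.primeIdealOf ⟨y, hy⟩).asIdeal := by
    let _ := Y.presheaf.algebra_section_stalk ⟨y, hy⟩
    have := V.2.isLocalization_stalk ⟨y, hy⟩
    rw [Scheme.mem_basicOpen _ _ _ hy]
    exact IsLocalization.AtPrime.isUnit_to_map_iff (Y.presheaf.stalk y)
      (V.2.primeIdealOf ⟨y, hy⟩).asIdeal s
  refine ⟨Y.basicOpen s, ringRes (Y.basicOpen_le s) ζ, (hmem x hxV).mpr hs, fun y hy ↦ ?_⟩
  have hyV := Y.basicOpen_le s hy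
  rw [germ_ringRes]
  let _ := Y.presheaf.algebra_section_stalk ⟨y, hyV⟩
  have := V.2.isLocalization_stalk ⟨y, hyV⟩
  exact H (V.2.primeIdealOf ⟨y, hyV⟩).asIdeal (Y.presheaf.stalk y) ((hmem y hyV).mp hy)

/-- A closed point in the closure of y has all its neighbourhoods containing y, so parameters near
closed points reach every point. -/
lemma exists_closed_point_forall_mem {Y : Type*} [TopologicalSpace Y] [JacobsonSpace Y] (y : Y) :
    ∃ x : Y, IsClosed {x} ∧ ∀ V : Set Y, IsOpen V → x ∈ V → y ∈ V := by
  obtain ⟨x, hx, hx'⟩ := nonempty_inter_closedPoints (Z := closure {y})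
    ⟨y, subset_closure rfl⟩ isClosed_closure.isLocallyClosed
  refine ⟨x, hx', fun V hV hxV ↦ ?_⟩
  obtain ⟨w, hw, rfl⟩ := mem_closure_iff.mp hx V hV hxV
  exact hw

lemma eq_zero_of_germ_eq_zero {Y : Scheme.{0}} {V : Y.Opens} (a : Γ(Y, V))
    (h : ∀ x hx, Y.presheaf.germ V x hx a = 0) : a = 0 :=
  TopCat.Presheaf.section_ext Y.sheaf V a 0 fun x hx ↦ (h x hx).trans (map_zero _).symm

/-- Vanishing of sections and membership in ideals of affine rings are both checked on germs. -/
lemma isLocalParameter_of_forall_isNilpotentParameter {Y : Scheme.{0}} {V : Y.Opens}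
    {z : Γ(Y, V)} {m : ℕ}
    (h : ∀ (y : Y) (hy : y ∈ V), IsNilpotentParameter m (Y.presheaf.germ V y hy z)) :
    IsLocalParameter (m + 1) V z where
  ideal_eq W hW := by
    refine le_antisymm (fun c hc ↦ ?_) ?_
    · rw [W.2.mem_ideal_iff]
      intro y hy
      rw [Ideal.map_span, Set.image_singleton]
      have e := germ_ringRes hW hy z
      erw [e]
      rw [← (h y (hW hy)).nilradical_eq]
      exact (mem_nilradical_ideal_iff.mp hc).map _
    · rw [Ideal.span_singleton_le_iff_mem, mem_nilradical_ideal_iff]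
      refine ⟨m + 1, eq_zero_of_germ_eq_zero _ fun y hy ↦ ?_⟩
      rw [map_pow, germ_ringRes, (h y (hW hy)).pow_succ_eq_zero]
  pow_eq_zero := eq_zero_of_germ_eq_zero _ fun y hy ↦ by
    rw [map_pow, (h y hy).pow_succ_eq_zero]
  exists_eq_of_pow_mul_eq_zero W hW k hk c hc := by
    suffices c ∈ Ideal.span {ringRes hW z ^ (m + 1 - k)} from Ideal.mem_span_singleton.mp this
    rw [W.2.mem_ideal_iff]
    intro y hy
    rw [Ideal.map_span, Set.image_singleton, Ideal.mem_span_singleton]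
    have e := germ_ringRes hW hy z
    have hc' := congr_arg (Y.presheaf.germ W.1 y hy) hc
    rw [map_mul, map_pow, map_zero, e] at hc'
    have := (h y (hW hy)).pow_dvd_of_pow_mul_eq_zero hk hc'
    rw [← e, ← map_pow] at this
    exact this

theorem IsPrimitiveMultipleCurve.exists_isLocalParameter (hY : IsPrimitiveMultipleCurve π n)
    (x : Y) : ∃ (V : Y.Opens) (z : Γ(Y, V)), x ∈ V ∧ IsLocalParameter n V z := by
  have := hY.locallyOfFiniteType
  have : IsLocallyNoetherian Y := LocallyOfFiniteType.isLocallyNoetherian π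
  have : JacobsonSpace Y := LocallyOfFiniteType.jacobsonSpace π
  have hloc (y : Y) : ∃ (m : ℕ) (V : Y.Opens) (ζ : Γ(Y, V)), y ∈ V ∧
      ∀ (w : Y) (hw : w ∈ V), IsNilpotentParameter m (Y.presheaf.germ V w hw ζ) := by
    obtain ⟨w, hw, hwy⟩ := exists_closed_point_forall_mem y
    obtain ⟨m, z, hz⟩ := hY.exists_isNilpotentParameter w hw
    obtain ⟨V, ζ, hwV, h⟩ := exists_open_isNilpotentParameter hz
    exact ⟨m, V, ζ, hwy V V.2 hwV, h⟩
  choose m V ζ hV hζ using hloc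
  have hconn : ConnectedSpace Y := by
    have := hY.support.connected
    have hs : Function.Surjective Y.nilradical.subschemeι := fun y ↦ by
      have : y ∈ Set.range Y.nilradical.subschemeι := by
        rw [Scheme.IdealSheafData.range_subschemeι, Scheme.support_nilradical]
        trivial
      exact this
    exact hs.connectedSpace Y.nilradical.subschemeι.continuous
  have hm : IsLocallyConstant m := by
    rw [IsLocallyConstant.iff_exists_open]
    exact fun y ↦ ⟨V y, (V y).2, hV y, fun w hw ↦ (hζ w w (hV w)).eq_of_nontrivial (hζ y w hw)⟩
  have hmx (y : Y) : m y = m x := hm.apply_eq_of_preconnectedSpace y x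
  have hpar (y : Y) : IsLocalParameter (m x + 1) (V y) (ζ y) :=
    hmx y ▸ isLocalParameter_of_forall_isNilpotentParameter (hζ y)
  -- The power m + 1 of the ideal vanishes near every point, so n ≤ m + 1 by minimality; if n ≤ m,
  -- then z^m would vanish at `x`.
  have hmn : n = m x + 1 := by
    refine le_antisymm (hY.multiplicity.2 ?_) (Nat.succ_le_of_lt (not_le.mp fun hle ↦ ?_))
    · refine Scheme.IdealSheafData.ext (funext fun W ↦ (Submodule.eq_bot_iff _).mpr fun c hc ↦ ?_)
      refine eq_zero_of_germ_eq_zero c fun y hy ↦ ?_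
      obtain ⟨W', hyW', hW'⟩ := exists_affine Y (U := V y ⊓ W.1) ⟨hV y, hy⟩
      have hc' := map_mem_ideal _ (V := W) (W := W') (homOfLE (hW'.trans inf_le_right)) hc
      change ringRes (hW'.trans inf_le_right) c ∈ Y.nilradical.ideal W' ^ (m x + 1) at hc'
      rw [(hpar y).ideal_eq W' (hW'.trans inf_le_left), Ideal.span_singleton_pow, ← map_pow,
        (hpar y).pow_eq_zero, map_zero, Ideal.span_singleton_eq_bot.mpr rfl, Ideal.mem_bot] at hc'
      rw [← germ_ringRes (hW'.trans inf_le_right) hyW', hc', map_zero]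
    · obtain ⟨W, hxW, hW⟩ := exists_affine Y (hV x)
      have hz : ringRes hW (ζ x) ^ n ∈ (Y.nilradical ^ n).ideal W :=
        Ideal.pow_mem_pow (((hpar x).ideal_eq W hW).ge (Ideal.mem_span_singleton_self _)) n
      rw [hY.multiplicity.1] at hz
      have hz : ringRes hW (ζ x) ^ n = 0 := hz
      refine (hζ x x (hV x)).pow_ne_zero ?_
      rw [← germ_ringRes hW hxW, ← map_pow, ← Nat.sub_add_cancel hle, pow_add, hz, mul_zero,
        map_zero]
  exact ⟨V x, ζ x, hV x, hmn ▸ hpar x⟩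

end PrimitiveCurve

end MultipleCurve

end

theorem lemma3p1p1 {Y : Scheme.{0}} (π : Y ⟶ Spec (.of ℂ)) (n : ℕ)
    (hY : IsPrimitiveMultipleCurve π n)
    (a b k : ℕ) (ha : 0 < a) (hb : 0 < b) (hk : 1 ≤ k) (hkn : k < n)
    (ℰ : Y.Modules) (hℰ : LocallyIsomorphic ℰ (quasiFreeModel Y a b k))
    (𝔼 : Y.Modules) (h𝔼 : IsVectorBundle 𝔼)
    (φ : 𝔼 ⟶ ℰ) (hφ : Epi φ)
    (hφC : ∃ ψ : restrictTo 𝔼 1 ≅ restrictTo ℰ 1, toRestrict 𝔼 1 ≫ ψ.hom = φ ≫ toRestrict ℰ 1) :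
    ∃! θ : restrictTo (kernel φ) k ≅
        tensor (filtrationQuotient hY.multiplicity.1 hkn.le ℰ) (idealPow Y k),
      ∀ (U : Y.Opens) (u : Γ((secondFiltration ℰ k).toModules, U)) (s : Γ(idealPow Y k, U))
        (v : Γ(𝔼, U)) (l : Γ(kernel φ, U)),
        φ.app U v = (secondFiltration ℰ k).ι.app U u →
        (kernel.ι φ).app U l = idealPow.val s • v →
        θ.hom.app U ((toRestrict (kernel φ) k).app U l) =
          tmul ((toFiltrationQuotient hY.multiplicity.1 hkn.le ℰ).app U u) s :=
  existsUnique_comparison_iso hY.multiplicity.1 hkn.le φ hY.exists_isLocalParameter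
    (h𝔼.exists_hasFrame n) (hℰ.exists_hasFrame (hasFrame_quasiFreeModel a b k))
    (by
      obtain ⟨ψ, hψ⟩ := hφC
      exact fun m hm ↦ mem_firstFiltration_one_of_app_eq_zero φ ψ hψ m hm)
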